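/- **Theorem 3.3.** Let $k$ be a field and $R=k[x,y]$ with the lexicographic order induced by $x>y$. For a nonzero $f\in R$ let $\operatorname{Lt}(f)$ be the largest monomial occurring in $f$; for an ideal $I$ let $\operatorname{Lt}(I)$ be the ideal generated by the $\operatorname{Lt}(f)$, $f\in I\setminus\{0\}$. Let $E\subseteq R$ be a monomial ideal with $\dim_k R/E<\infty$. Put $$V_0(E)=\{I:\operatorname{Lt}(I)=E\},\qquad V_1(E)=\{I\in V_0(E): y\in\sqrt I\},$$ $$V_2(E)=\{I\in V_0(E):\sqrt I=(x,y)\},\qquad V_3(E)=\{I\in V_0(E): I\text{ is homogeneous}\}.$$ Let $t=\min\{j: x^j\in E\}$, $m_i=\min\{j: x^{t-i}y^j\in E\}$ for $0\le i\le t$, $d_i=m_i-m_{i-1}$ for $1\le i\le t$, and $u_{ij}=m_j-m_{i-1}+i-j$ for $1\le i\le t+1$, $1\le j\le t$. Let $$\mathcal S(E)=\{(i,j): 1\le j<i\le t+1,\ 0\le u_{ij}<d_j\}.$$ Let $M_0(E)$ be the $(t+1)\times t$ matrix with $(j,j)$ entry $y^{d_j}$ and $(j+1,j)$ entry $-x$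 for $1\le j\le t$, and all other entries $0$. Let $T_0(E)$ be the set of $(t+1)\times t$ matrices $N=(n_{ij})$ with entries in $k[y]$ such that $n_{ij}=0$ for $i<j$ and $\deg n_{ij}<d_j$ for $i\ge j$ (with $\deg 0=-\infty$). Consider the following conditions on $N\in T_0(E)$. 1. $n_{jj}=0$ for $j=1,\dots,t$. 2. For every $j$ with $d_j>0$, the polynomial $n_{ij}$ has no constant term for $i=j+1,\dots,\kappa+1$, where $\kappa=\max\{v: j\le v\le t,\ m_v=m_j\}$. 3. $n_{ij}=0$ if $(i,j)\notin\mathcal S(E)$, and $n_{ij}=p_{ij}y^{u_{ij}}$ with $p_{ij}\in k$ if $(i,j)\in\mathcal S(E)$. Let $T_1(E)$, $T_2(E)$, $T_3(E)$ be the sets of those $N\in T_0(E)$ that satisfy (1), (1) and (2), and (3), respectively. For $N\in T_0(E)$ let $\phi(N)$ be the ideal of $R$ generated by the $t$-minors of $M_0(E)+N$. Then: * $\phi$ is a bijection from $T_0(E)$ onto $V_0(E)$; * $\phi$ restricts to bijections $T_1(E)\to V_1(E)$ and $T_3(E)\to V_3(E)$ and, if $E\ne R$, to a bijection $T_2(E)\to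 V_2(E)$; * consequently each $I\in V_0(E)$ has a canonical Hilbert–Burch matrix: there is exactly one $N\in T_0(E)$ such that $M_0(E)+N$ is a Hilbert–Burch matrix of $I$, that is, its $t$-minors generate $I$ and its columns generate the module of syzygies of its signed $t$-minors $f_0,\dots,f_t$, where $f_i$ is $(-1)^{t-i}$ times the determinant of the matrix obtained by deleting row $i+1$. -/

import Mathlib

namespace CanonicalHB

/-- The polynomial ring `k[x, y]`; the variable `x` is `X 0` and `y` is `X 1`. -/
abbrev R (k : Type*) [Field k] : Type _ := MvPolynomial (Fin 2) k

noncomputable section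

variable {k : Type*} [Field k]

attribute [local instance] MvPolynomial.gradedAlgebra

/-- An ideal of `k[x, y]` is monomial if it is generated by a set of monomials. -/
def IsMonomialIdeal (E : Ideal (R k)) : Prop :=
  ∃ S : Set (Fin 2 →₀ ℕ), E = Ideal.span ((fun s => MvPolynomial.monomial s (1 : k)) '' S)

/-- `Lt(I)`: the ideal generated by the leading monomials of the nonzero elements of `I`, for the
lexicographic order; Mathlib's `MonomialOrder.lex` on `Fin 2` has `X 0 > X 1`, that is, `x > y`. -/
def Lt (I : Ideal (R k)) : Ideal (R k) :=
  Ideal.span {g | ∃ f ∈ I, f ≠ 0 ∧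
    g = MvPolynomial.monomial (MonomialOrder.lex.degree f) (1 : k)}

/-- The ideals with leading-term ideal `E`. -/
def V0 (E : Ideal (R k)) : Set (Ideal (R k)) :=
  {I | Lt I = E}

/-- The ideals `I` with `Lt(I) = E` and `y ∈ √I`. -/
def V1 (E : Ideal (R k)) : Set (Ideal (R k)) :=
  {I | Lt I = E ∧ MvPolynomial.X 1 ∈ I.radical}

/-- The ideals `I` with `Lt(I) = E` and `√I = (x, y)`. -/
def V2 (E : Ideal (R k)) : Set (Ideal (R k)) :=
  {I | Lt I = E ∧ I.radical = Ideal.span {MvPolynomial.X 0, MvPolynomial.X 1}}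

/-- The ideals `I` with `Lt(I) = E` that are homogeneous for the standard grading. -/
def V3 (E : Ideal (R k)) : Set (Ideal (R k)) :=
  {I | Lt I = E ∧ I.IsHomogeneous (MvPolynomial.homogeneousSubmodule (Fin 2) k)}

/-- `t = min {j : x ^ j ∈ E}`. -/
def t (E : Ideal (R k)) : ℕ :=
  sInf {j | (MvPolynomial.X 0 : R k) ^ j ∈ E}

/-- `m_i = min {j : x ^ (t - i) * y ^ j ∈ E}`, for `0 ≤ i ≤ t`. -/
def m (E : Ideal (R k)) (i : ℕ) : ℕ :=
  sInf {j | (MvPolynomial.X 0 : R k) ^ (t E - i) * MvPolynomial.X 1 ^ j ∈ E}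

/-- `d_i = m_i - m_{i-1}`, for `1 ≤ i ≤ t`. (There `m_{i-1} ≤ m_i`, so nothing is truncated.) -/
def d (E : Ideal (R k)) (i : ℕ) : ℕ :=
  m E i - m E (i - 1)

/-- `u_{ij} = m_j - m_{i-1} + i - j`, for `1 ≤ i ≤ t + 1` and `1 ≤ j ≤ t`. -/
def u (E : Ideal (R k)) (i j : ℕ) : ℤ :=
  (m E j : ℤ) - (m E (i - 1) : ℤ) + (i : ℤ) - (j : ℤ)

/-- The set `S(E)` of the `(i, j)` with `1 ≤ j < i ≤ t + 1` and `0 ≤ u_{ij} < d_j`. -/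
def S (E : Ideal (R k)) : Set (ℕ × ℕ) :=
  {p | 1 ≤ p.2 ∧ p.2 < p.1 ∧ p.1 ≤ t E + 1 ∧ 0 ≤ u E p.1 p.2 ∧ u E p.1 p.2 < (d E p.2 : ℤ)}

/-- `max {v : j ≤ v ≤ t and m_v = m_j}`, for `1 ≤ j ≤ t`. -/
def lastEq (E : Ideal (R k)) (j : ℕ) : ℕ :=
  sSup {v | j ≤ v ∧ v ≤ t E ∧ m E v = m E j}

/-- The `(t + 1) × t` matrix `M₀(E)`, with diagonal entries `y ^ d_j`, entries `-x` just below the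
diagonal, and `0` elsewhere. Here and below, the index `a : Fin _` stands for the row or column
number `a + 1`. -/
def M0 (E : Ideal (R k)) : Matrix (Fin (t E + 1)) (Fin (t E)) (R k) :=
  Matrix.of fun a b =>
    if (a : ℕ) = (b : ℕ) then MvPolynomial.X 1 ^ d E (b + 1)
    else if (a : ℕ) = (b : ℕ) + 1 then -MvPolynomial.X 0
    else 0

/-- The `(t + 1) × t` matrices `N` with entries in `k[y]` such that `n_{ij} = 0` for `i < j` and
`n_{ij}` has degree `< d_j` for `j ≤ i` (the zero polynomial has degree `⊥`). -/
def T0 (E : Ideal (R k)) : Set (Matrix (Fin (t E + 1)) (Fin (t E)) (Polynomial k)) :=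
  {N | ∀ (a : Fin (t E + 1)) (b : Fin (t E)),
    ((a : ℕ) < (b : ℕ) → N a b = 0) ∧
    ((b : ℕ) ≤ (a : ℕ) → (N a b).degree < (d E (b + 1) : WithBot ℕ))}

/-- Condition (1): `n_{jj} = 0` for `1 ≤ j ≤ t`. -/
def Cond1 (E : Ideal (R k)) (N : Matrix (Fin (t E + 1)) (Fin (t E)) (Polynomial k)) : Prop :=
  ∀ b : Fin (t E), N b.castSucc b = 0

/-- Condition (2): for every `j` with `d_j > 0`, the polynomial `n_{ij}` has no constant term for
`i = j + 1, …, κ + 1`, where `κ = max {v : j ≤ v ≤ t and m_v = m_j}`. -/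
def Cond2 (E : Ideal (R k)) (N : Matrix (Fin (t E + 1)) (Fin (t E)) (Polynomial k)) : Prop :=
  ∀ b : Fin (t E), 0 < d E (b + 1) → ∀ a : Fin (t E + 1),
    (b + 1 : ℕ) + 1 ≤ (a + 1 : ℕ) → (a + 1 : ℕ) ≤ lastEq E (b + 1) + 1 → (N a b).coeff 0 = 0

/-- Condition (3): `n_{ij} = 0` if `(i, j) ∉ S(E)`, and `n_{ij} = p_{ij} y ^ u_{ij}` for some
`p_{ij} ∈ k` if `(i, j) ∈ S(E)` (in which case `u_{ij} ≥ 0`). -/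
def Cond3 (E : Ideal (R k)) (N : Matrix (Fin (t E + 1)) (Fin (t E)) (Polynomial k)) : Prop :=
  ∀ (a : Fin (t E + 1)) (b : Fin (t E)),
    (((a + 1 : ℕ), (b + 1 : ℕ)) ∉ S E → N a b = 0) ∧
    (((a + 1 : ℕ), (b + 1 : ℕ)) ∈ S E →
      ∃ p : k, N a b = Polynomial.C p * Polynomial.X ^ (u E (a + 1) (b + 1)).toNat)

/-- The matrices in `T₀(E)` that satisfy (1). -/
def T1 (E : Ideal (R k)) : Set (Matrix (Fin (t E + 1)) (Fin (t E)) (Polynomial k)) :=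
  {N | N ∈ T0 E ∧ Cond1 E N}

/-- The matrices in `T₀(E)` that satisfy (1) and (2). -/
def T2 (E : Ideal (R k)) : Set (Matrix (Fin (t E + 1)) (Fin (t E)) (Polynomial k)) :=
  {N | N ∈ T0 E ∧ Cond1 E N ∧ Cond2 E N}

/-- The matrices in `T₀(E)` that satisfy (3). -/
def T3 (E : Ideal (R k)) : Set (Matrix (Fin (t E + 1)) (Fin (t E)) (Polynomial k)) :=
  {N | N ∈ T0 E ∧ Cond3 E N}

/-- The matrix `M₀(E) + N` over `k[x, y]`; the indeterminate of `k[y]` is sent to `y`. -/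
def pert (E : Ideal (R k)) (N : Matrix (Fin (t E + 1)) (Fin (t E)) (Polynomial k)) :
    Matrix (Fin (t E + 1)) (Fin (t E)) (R k) :=
  M0 E + N.map (Polynomial.aeval (MvPolynomial.X 1 : R k))

/-- The ideal generated by the `r`-minors of a matrix: the determinants of the `r × r` submatrices
given by a choice of `r` rows and `r` columns. -/
def minorsIdeal {A : Type*} [CommRing A] {p q : ℕ} (r : ℕ) (M : Matrix (Fin p) (Fin q) A) :
    Ideal A :=
  Ideal.span {g | ∃ (f : Fin r ↪o Fin p) (h : Fin r ↪o Fin q), g = (M.submatrix f h).det}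

/-- The map `φ`, sending `N` to the ideal of `t`-minors of `M₀(E) + N`. -/
def phi (E : Ideal (R k)) (N : Matrix (Fin (t E + 1)) (Fin (t E)) (Polynomial k)) : Ideal (R k) :=
  minorsIdeal (t E) (pert E N)

/-- The signed maximal minor `(-1) ^ (r - i) * det`, where the determinant is that of the matrix
obtained by deleting the row with index `i ∈ {0, …, r}`. -/
def signedMinor {A : Type*} [CommRing A] {r : ℕ} (M : Matrix (Fin (r + 1)) (Fin r) A)
    (i : Fin (r + 1)) : A :=
  (-1) ^ (r - (i : ℕ)) * (M.submatrix i.succAbove id).det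

/-- `M` is a Hilbert–Burch matrix of `I`: its maximal minors generate `I`, and its columns generate
the syzygy module of its signed maximal minors. -/
def IsHilbertBurch {A : Type*} [CommRing A] {r : ℕ} (M : Matrix (Fin (r + 1)) (Fin r) A)
    (I : Ideal A) : Prop :=
  minorsIdeal r M = I ∧
  ∀ v : Fin (r + 1) → A,
    v ∈ Submodule.span A (Set.range M.col) ↔ ∑ i, v i * signedMinor M i = 0

end

end CanonicalHB

/-! View R as k[y][x]. For the lexicographic order, the leading monomial of f is x^a y^b, where a is
the x-degree of f and b is the y-degree of its leading coefficient. So Lt(I) = E says that, for 0 ≤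
i ≤ t, the least y-degree of a leading coefficient of an element of I of x-degree t - i is m_i
(`HasStaircase`).

The matrix M₀(E) + N is a lower triangular matrix P over k[y] with -x added just below the diagonal;
its diagonal entries q_j are monic of degree d_j. Its columns annihilate the signed minors F_0, …,
F_t, that is, x F_j = q_j F_{j-1} + ∑_{a ≥ j} n_{a+1,j} F_a. Going down from F_t = q_1 ⋯ q_t, one
finds that F_i has x-degree t - i and leading coefficient q_1 ⋯ q_i (`IsLowerTri.hasLeading`). The
relations also eliminate multiplication by x on every F_i except F_0, which is monic. Hence the
elements of the ideal of x-degree at most t - i are the unique k[y]-combinations of F_i, …, F_t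
(`HasLeading.exists_sum_eq`, `HasLeading.linearIndependent`). This gives the staircase and the
syzygies.

Conversely, an ideal with this staircase has leading coefficients in x-degree t - i that are the
multiples of a monic α_i. The F_i are built for decreasing i: the coefficients of each relation are
divided by q_j and the quotients are absorbed into F_{j-1} (`exists_canonical_family`). Uniqueness
holds because a relation whose coefficients are already remainders is trivial
(`IsCanonical.eq_zero_of_relation`).

For the restrictions, y ∈ √I means that every q_j is a power of y. Then F_i = y^{m_i} G_i, so for E
≠ R the ideal reduces modulo y to the one generated by F_0, and x ∈ √I means F_0 ≡ x^t modulo y; the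
recursion turns this into vanishing constant terms. Homogeneity is read off by taking graded
components of the relations and applying uniqueness. -/

namespace CanonicalHB
open Polynomial

/-! ### Signed maximal minors. -/

section Minors

variable {B : Type*} [CommRing B] {n : ℕ}

theorem sum_mul_signedMinor (M : Matrix (Fin (n + 1)) (Fin n) B) (b : Fin n) :
    ∑ a, M a b * signedMinor M a = 0 := by
  -- Column b is repeated as an additional last column, and the vanishing determinant is expanded
  -- along it.
  let M' : Matrix (Fin (n + 1)) (Fin (n + 1)) B :=
    Matrix.of fun a => Fin.snoc (α := fun _ => B) (M a) (M a b)
  have h0 : M'.det = 0 := by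
    refine Matrix.det_zero_of_column_eq (i := b.castSucc) (j := Fin.last n)
      (Fin.castSucc_lt_last b).ne fun a => ?_
    simp [M']
  rw [Matrix.det_succ_column M' (Fin.last n)] at h0
  rw [← h0]
  refine Finset.sum_congr rfl fun a _ => ?_
  have h1 : M'.submatrix a.succAbove (Fin.last n).succAbove = M.submatrix a.succAbove id := by
    ext i j
    simp [M']
  have h2 : ((-1 : B)) ^ (n - (a : ℕ)) = (-1) ^ ((a : ℕ) + ((Fin.last n : Fin (n + 1)) : ℕ)) := by
    have : (a : ℕ) + ((Fin.last n : Fin (n + 1)) : ℕ) = (n - a) + 2 * a := by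
      have := a.is_lt
      simp only [Fin.val_last]
      omega
    rw [this, pow_add, pow_mul]
    simp
  rw [h1, signedMinor, h2]
  simp only [M', Matrix.of_apply, Fin.snoc_last]
  ring

theorem minorsIdeal_eq_span (M : Matrix (Fin (n + 1)) (Fin n) B) :
    minorsIdeal n M = Ideal.span (Set.range (signedMinor M)) := by
  apply le_antisymm
  · refine Ideal.span_le.2 ?_
    rintro _ ⟨f, h, rfl⟩
    have hh : h = RelEmbedding.refl _ := by
      ext i
      have := (OrderEmbedding.range_inj (f := h) (g := RelEmbedding.refl _)).1 ?_
      · rw [this]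
      · rw [(Finite.injective_iff_surjective.1 h.injective).range_eq]
        exact Function.surjective_id.range_eq.symm
    obtain ⟨i, hi⟩ : ∃ i, i ∉ Set.range f := by
      by_contra! hc
      have := Fintype.card_le_of_surjective f (fun i => hc i)
      simp at this
    have hf : f = Fin.succAboveOrderEmb i := by
      refine (OrderEmbedding.range_inj).1 ?_
      have h1 : Set.range f ⊆ {i}ᶜ := by
        rintro _ ⟨j, rfl⟩ rfl
        exact hi ⟨j, rfl⟩
      have h2 : Set.range (Fin.succAboveOrderEmb i) = {i}ᶜ := by
        simp [Fin.succAboveOrderEmb, Fin.range_succAbove]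
      rw [h2]
      refine Set.eq_of_subset_of_ncard_le h1 ?_
      rw [← h2, ← Nat.card_coe_set_eq, ← Nat.card_coe_set_eq,
        Nat.card_congr (Equiv.ofInjective _ f.injective).symm,
        Nat.card_congr (Equiv.ofInjective _ (Fin.succAboveOrderEmb i).injective).symm]
    have h3 : (M.submatrix f h).det = (-1) ^ (n - (i : ℕ)) * signedMinor M i := by
      subst hh hf
      rw [signedMinor, ← mul_assoc, ← mul_pow]
      simp
      rfl
    rw [h3]
    exact Ideal.mul_mem_left _ _ (Ideal.subset_span ⟨i, rfl⟩)
  · refine Ideal.span_le.2 ?_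
    rintro _ ⟨i, rfl⟩
    refine Ideal.mul_mem_left _ _ (Ideal.subset_span
      ⟨Fin.succAboveOrderEmb i, RelEmbedding.refl _, rfl⟩)

end Minors

/-! ### Triangular relation matrices over A[X], their minors and syzygies. -/

section Relations

variable {A : Type*} [CommRing A] {n : ℕ}

/-- The matrix `P - X • L`, where `L` has ones just below the diagonal and zeros elsewhere. -/
noncomputable def relMatrix (P : Matrix (Fin (n + 1)) (Fin n) A) :
    Matrix (Fin (n + 1)) (Fin n) A[X] :=
  Matrix.of fun a b => C (P a b) - if a = b.succ then X else 0

/-- The entries above the main diagonal vanish. -/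
def IsLowerTri (P : Matrix (Fin (n + 1)) (Fin n) A) : Prop :=
  ∀ (a : Fin (n + 1)) (b : Fin n), a < b.castSucc → P a b = 0

/-- The family `F` is annihilated by the columns of `relMatrix P`. -/
def IsRel (P : Matrix (Fin (n + 1)) (Fin n) A) (F : Fin (n + 1) → A[X]) : Prop :=
  ∀ b, ∑ a, C (P a b) * F a = X * F b.succ

theorem sum_relMatrix_mul (P : Matrix (Fin (n + 1)) (Fin n) A) (F : Fin (n + 1) → A[X])
    (b : Fin n) : ∑ a, relMatrix P a b * F a = ∑ a, C (P a b) * F a - X * F b.succ := by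
  simp [relMatrix, sub_mul, Finset.sum_sub_distrib, ite_mul]

theorem isRel_signedMinor (P : Matrix (Fin (n + 1)) (Fin n) A) :
    IsRel P (signedMinor (relMatrix P)) := fun b => by
  rw [← sub_eq_zero, ← sum_relMatrix_mul]
  exact sum_mul_signedMinor _ b

theorem IsLowerTri.sum_eq {P : Matrix (Fin (n + 1)) (Fin n) A} (hP : IsLowerTri P)
    (F : Fin (n + 1) → A[X]) (b : Fin n) :
    ∑ a, C (P a b) * F a = C (P b.castSucc b) * F b.castSucc +
      ∑ a ∈ Finset.Ici b.succ, C (P a b) * F a := by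
  have h : Finset.Ici b.castSucc = insert b.castSucc (Finset.Ici b.succ) := by
    ext a
    simp only [Finset.mem_Ici, Finset.mem_insert, Fin.le_def, Fin.ext_iff, Fin.val_castSucc,
      Fin.val_succ]
    omega
  have h' : b.castSucc ∉ Finset.Ici b.succ := by simp [Fin.le_def]
  rw [← Finset.sum_insert (f := fun a => C (P a b) * F a) h', ← h]
  refine (Finset.sum_subset (Finset.subset_univ _) fun a _ ha => ?_).symm
  rw [hP a b (by simpa using ha)]
  simp

theorem signedMinor_last {P : Matrix (Fin (n + 1)) (Fin n) A} (hP : IsLowerTri P) :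
    signedMinor (relMatrix P) (Fin.last n) = C (∏ b, P b.castSucc b) := by
  have : ((relMatrix P).submatrix (Fin.last n).succAbove id).IsLowerTriangular := by
    intro i j hij
    have hij : i < j := hij
    have h1 : i.castSucc ≠ j.succ := by
      rw [Ne, Fin.ext_iff]; simp only [Fin.val_castSucc, Fin.val_succ]
      have := Fin.lt_def.1 hij
      omega
    simp [relMatrix, hP i.castSucc j (by simpa using hij), h1]
  rw [signedMinor, Matrix.det_of_isLowerTriangular _ this]
  have h1 : ∀ i : Fin n, i.castSucc ≠ i.succ := fun i => by simp [Fin.ext_iff]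
  simp [relMatrix, h1]

theorem IsRel.sub {P : Matrix (Fin (n + 1)) (Fin n) A} {F F' : Fin (n + 1) → A[X]}
    (h : IsRel P F) (h' : IsRel P F') : IsRel P (F - F') := fun b => by
  simp only [Pi.sub_apply, mul_sub, Finset.sum_sub_distrib, h b, h' b]

/-- The relation for b expresses a nonzero multiple of `F b.castSucc` through later members, so the
last member determines the whole family. -/
theorem IsRel.eq_zero [IsDomain A] {P : Matrix (Fin (n + 1)) (Fin n) A} {F : Fin (n + 1) → A[X]}
    (h : IsRel P F) (hP : IsLowerTri P) (hq : ∀ b : Fin n, P b.castSucc b ≠ 0)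
    (hlast : F (Fin.last n) = 0) : F = 0 := by
  funext i
  induction i using WellFoundedGT.induction with
  | ind i ih =>
    rcases Fin.eq_castSucc_or_eq_last i with ⟨b, rfl⟩ | rfl
    · have h1 := h b
      rw [hP.sum_eq, ih _ b.castSucc_lt_succ, Finset.sum_eq_zero] at h1
      · simpa [hq b] using h1
      · intro a ha
        rw [ih a (lt_of_lt_of_le b.castSucc_lt_succ (by simpa using ha))]
        simp
    · exact hlast

theorem IsRel.ext [IsDomain A] {P : Matrix (Fin (n + 1)) (Fin n) A} {F F' : Fin (n + 1) → A[X]}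
    (h : IsRel P F) (h' : IsRel P F') (hP : IsLowerTri P) (hq : ∀ b : Fin n, P b.castSucc b ≠ 0)
    (hlast : F (Fin.last n) = F' (Fin.last n)) : F = F' :=
  sub_eq_zero.1 ((h.sub h').eq_zero hP hq (by simp [hlast]))

/-- A triangular family with ones on the diagonal has monic relations of the expected degrees. -/
theorem IsRel.monic [Nontrivial A] {P : Matrix (Fin (n + 1)) (Fin n) A} {G : Fin (n + 1) → A[X]}
    (h : IsRel P G) (hP : IsLowerTri P) (hq : ∀ b : Fin n, P b.castSucc b = 1)
    (hlast : G (Fin.last n) = 1) (i : Fin (n + 1)) :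
    (G i).Monic ∧ (G i).natDegree = n - i := by
  induction i using WellFoundedGT.induction with
  | ind i ih =>
    rcases Fin.eq_castSucc_or_eq_last i with ⟨b, rfl⟩ | rfl
    · have h1 := h b
      rw [hP.sum_eq, hq] at h1
      have h2 : G b.castSucc = X * G b.succ - ∑ a ∈ Finset.Ici b.succ, C (P a b) * G a := by
        rw [← h1]; simp
      obtain ⟨hm, hd⟩ := ih _ b.castSucc_lt_succ
      have hm' : (X * G b.succ).Monic := monic_X.mul hm
      have hd' : (X * G b.succ).natDegree = n - b := by
        rw [monic_X.natDegree_mul hm, hd, natDegree_X]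
        have := b.is_lt
        simp only [Fin.val_succ]
        omega
      have hlt : (∑ a ∈ Finset.Ici b.succ, C (P a b) * G a).degree < (X * G b.succ).degree := by
        rw [degree_eq_natDegree hm'.ne_zero, hd', degree_lt_iff_coeff_zero]
        intro N hN
        rw [finsetSum_coeff]
        refine Finset.sum_eq_zero fun a ha => ?_
        have hba : b.succ ≤ a := by simpa using ha
        rw [coeff_C_mul, coeff_eq_zero_of_natDegree_lt, mul_zero]
        rw [(ih a (lt_of_lt_of_le b.castSucc_lt_succ hba)).2]
        have := b.is_lt
        have := Fin.le_def.1 hba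
        simp only [Fin.val_succ] at this
        omega
      rw [h2]
      refine ⟨hm'.sub_of_left hlt, ?_⟩
      rw [natDegree_eq_of_degree_eq (degree_sub_eq_left_of_degree_lt hlt), hd']
      rfl
    · simp [hlast]


/-- Rescaling by the partial products α of the diagonal turns the diagonal entries into 1, at the
cost of multiplying the entry (a, b) by the quotient ρ of α a by α b.succ. The minors of the
rescaled matrix, multiplied by α, satisfy the original relations, so they are F by uniqueness. -/
theorem IsLowerTri.exists_factor [IsDomain A] {P : Matrix (Fin (n + 1)) (Fin n) A}
    (hP : IsLowerTri P) (hq : ∀ b : Fin n, P b.castSucc b ≠ 0) {α : Fin (n + 1) → A}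
    (hα : ∀ b : Fin n, α b.succ = α b.castSucc * P b.castSucc b)
    {ρ : Fin n → Fin (n + 1) → A} (hρ : ∀ b a, b.succ ≤ a → α a = α b.succ * ρ b a)
    {F : Fin (n + 1) → A[X]} (hF : IsRel P F) (hlast : F (Fin.last n) = C (α (Fin.last n))) :
    ∃ G : Fin (n + 1) → A[X], (∀ a, F a = C (α a) * G a) ∧
      (∀ a, (G a).Monic ∧ (G a).natDegree = n - a) ∧
      ∀ b : Fin n, G b.castSucc + ∑ a ∈ Finset.Ici b.succ, C (P a b * ρ b a) * G a =
        X * G b.succ := by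
  let P' : Matrix (Fin (n + 1)) (Fin n) A := Matrix.of fun a b =>
    if a = b.castSucc then 1 else P a b * ρ b a
  have hdiag : ∀ b : Fin n, P' b.castSucc b = 1 := fun b => by simp [P']
  have hoff : ∀ (a : Fin (n + 1)) (b : Fin n), b.succ ≤ a → P' a b = P a b * ρ b a :=
    fun a b hab => by
      have : a ≠ b.castSucc := (lt_of_lt_of_le b.castSucc_lt_succ hab).ne'
      simp [P', this]
  have hP' : IsLowerTri P' := fun a b hab => by simp [P', hP a b hab, hab.ne]
  have hrel := isRel_signedMinor P'
  have hl := signedMinor_last hP'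
  set G := signedMinor (relMatrix P') with hG
  have hl' : G (Fin.last n) = 1 := by rw [hl]; simp [hdiag]
  have hG' : ∀ b : Fin n, G b.castSucc + ∑ a ∈ Finset.Ici b.succ, C (P a b * ρ b a) * G a =
        X * G b.succ := fun b => by
    rw [← hrel b, hP'.sum_eq, hdiag, C_1, one_mul]
    congr 1
    exact Finset.sum_congr rfl fun a ha => by rw [hoff a b (by simpa using ha)]
  refine ⟨G, ?_, hrel.monic hP' hdiag hl', hG'⟩
  have : F = fun a => C (α a) * G a := by
    refine hF.ext (fun b => ?_) hP hq (by simp [hlast, hl'])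
    have h1 : X * (C (α b.succ) * G b.succ) = C (α b.succ) * (X * G b.succ) := by ring
    rw [hP.sum_eq, h1, ← hG' b, mul_add, Finset.mul_sum, hα b, C_mul]
    congr 1
    · ring
    · refine Finset.sum_congr rfl fun a ha => ?_
      rw [hρ b a (by simpa using ha), hα b]
      simp only [C_mul]
      ring
  exact fun a => congrFun this a

/-- The degrees and the leading coefficients in `X` of a family of polynomials. -/
structure HasLeading (F : Fin (n + 1) → A[X]) (α : Fin (n + 1) → A) : Prop where
  natDegree_le : ∀ a, (F a).natDegree ≤ n - a
  coeff : ∀ a, (F a).coeff (n - a) = α a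

theorem IsLowerTri.hasLeading [IsDomain A] {P : Matrix (Fin (n + 1)) (Fin n) A}
    (hP : IsLowerTri P) (hq : ∀ b : Fin n, P b.castSucc b ≠ 0) :
    HasLeading (signedMinor (relMatrix P)) (Fin.partialProd fun b => P b.castSucc b) := by
  set α := Fin.partialProd fun b : Fin n => P b.castSucc b with hα
  have hdvd : ∀ (b : Fin n) (a : Fin (n + 1)), ∃ r, b.succ ≤ a → α a = α b.succ * r := by
    intro b a
    by_cases h : b.succ ≤ a
    · have : α b.succ ∣ α a := by
        induction a using Fin.induction with
        | zero => simp at h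
        | succ i ih =>
          rcases h.eq_or_lt with h | h
          · rw [h]
          · rw [hα, Fin.partialProd_succ _ i]
            exact (ih (by rw [Fin.lt_def] at h; rw [Fin.le_def]; simp at *; omega)).mul_right _
      obtain ⟨r, hr⟩ := this
      exact ⟨r, fun _ => hr⟩
    · exact ⟨0, fun h' => absurd h' h⟩
  choose ρ hρ using hdvd
  obtain ⟨G, h1, h2, -⟩ := hP.exists_factor hq (α := α) (fun b => Fin.partialProd_succ _ b) hρ
    (isRel_signedMinor P) (by
      rw [signedMinor_last hP, hα, Fin.partialProd, Fin.val_last, List.take_of_length_le (by simp),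
        List.prod_ofFn])
  refine ⟨fun a => ?_, fun a => ?_⟩
  · rw [h1, ← (h2 a).2]
    exact natDegree_C_mul_le _ _
  · rw [h1, ← (h2 a).2, coeff_C_mul, coeff_natDegree, (h2 a).1]
    simp

/-- The members have distinct X-degree bounds n - a, attained with nonzero coefficients, so the
coefficients of a combination can be peeled off from the top degree downwards. -/
theorem HasLeading.coeff_zero_of_sum {F : Fin (n + 1) → A[X]} [IsDomain A] {α : Fin (n + 1) → A}
    (hF : HasLeading F α) (hα : ∀ a, α a ≠ 0) (s : Fin (n + 1) → A) (i : ℕ)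
    (h : ∀ a : Fin (n + 1), (a : ℕ) < i → (∑ c, C (s c) * F c).coeff (n - a) = 0)
    (a : Fin (n + 1)) (ha : (a : ℕ) < i) : s a = 0 := by
  induction a using WellFoundedLT.induction with
  | ind a ih =>
    have h1 := h a ha
    rw [finsetSum_coeff, Finset.sum_eq_single a] at h1
    · rw [coeff_C_mul, hF.coeff] at h1
      exact (mul_eq_zero.1 h1).resolve_right (hα a)
    · intro c _ hc
      rcases lt_or_gt_of_ne hc with hc | hc
      · simp [ih c hc ((Fin.lt_def.1 hc).trans ha)]
      · rw [coeff_C_mul, coeff_eq_zero_of_natDegree_lt, mul_zero]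
        refine (hF.natDegree_le c).trans_lt ?_
        have := c.is_lt
        have := Fin.lt_def.1 hc
        omega
    · simp

theorem HasLeading.linearIndependent {F : Fin (n + 1) → A[X]} [IsDomain A] {α : Fin (n + 1) → A}
    (hF : HasLeading F α) (hα : ∀ a, α a ≠ 0) (s : Fin (n + 1) → A)
    (h : ∑ c, C (s c) * F c = 0) : s = 0 :=
  funext fun a => hF.coeff_zero_of_sum hα s (n + 1) (by simp [h]) a a.is_lt

/-- Modulo the columns of `relMatrix P`, all entries of a vector but the first can be made
constant. -/
theorem exists_normalForm (P : Matrix (Fin (n + 1)) (Fin n) A) (v : Fin (n + 1) → A[X]) :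
    ∃ w ∈ Submodule.span A[X] (Set.range (relMatrix P).col),
      ∀ a, a ≠ 0 → ∃ s, v a - w a = C s := by
  set W := Submodule.span A[X] (Set.range (relMatrix P).col)
  let N : Submodule A[X] (Fin (n + 1) → A[X]) :=
    { carrier := {v | ∃ w ∈ W, ∀ a, a ≠ 0 → ∃ s, v a - w a = C s}
      zero_mem' := ⟨0, W.zero_mem, fun a _ => ⟨0, by simp⟩⟩
      add_mem' := by
        rintro v v' ⟨w, hw, h⟩ ⟨w', hw', h'⟩
        refine ⟨w + w', W.add_mem hw hw', fun a ha => ?_⟩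
        obtain ⟨s, hs⟩ := h a ha
        obtain ⟨s', hs'⟩ := h' a ha
        exact ⟨s + s', by rw [C_add, ← hs, ← hs']; simp; ring⟩
      smul_mem' := by
        have hC : ∀ (r : A) (v : Fin (n + 1) → A[X]),
            (∃ w ∈ W, ∀ a, a ≠ 0 → ∃ s, v a - w a = C s) →
            ∃ w ∈ W, ∀ a, a ≠ 0 → ∃ s, (C r • v) a - w a = C s := by
          rintro r v ⟨w, hw, h⟩
          refine ⟨C r • w, W.smul_mem _ hw, fun a ha => ?_⟩
          obtain ⟨s, hs⟩ := h a ha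
          exact ⟨r * s, by rw [C_mul, ← hs]; simp; ring⟩
        have hX : ∀ (v : Fin (n + 1) → A[X]),
            (∃ w ∈ W, ∀ a, a ≠ 0 → ∃ s, v a - w a = C s) →
            ∃ w ∈ W, ∀ a, a ≠ 0 → ∃ s, ((X : A[X]) • v) a - w a = C s := by
          rintro v ⟨w, hw, h⟩
          choose! s hs using h
          -- Multiplication by X creates the terms X * s at the positions b.succ. The column b has
          -- -X there and constants elsewhere, so adding s times it removes the term and leaves
          -- constants.
          refine ⟨(X : A[X]) • w - ∑ b : Fin n, C (s b.succ) • (relMatrix P).col b,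
            W.sub_mem (W.smul_mem _ hw) (W.sum_mem fun b _ => W.smul_mem _
              (Submodule.subset_span ⟨b, rfl⟩)), fun a ha => ?_⟩
          refine ⟨∑ b : Fin n, s b.succ * P a b, ?_⟩
          obtain ⟨c, rfl⟩ := Fin.exists_succ_eq.2 ha
          have h1 : v c.succ = w c.succ + C (s c.succ) := by rw [← hs _ ha]; ring
          simp only [Pi.smul_apply, Pi.sub_apply, Finset.sum_apply, Matrix.col_apply, h1, relMatrix,
            Matrix.of_apply, smul_eq_mul, mul_sub, Finset.sum_sub_distrib, map_sum, C_mul]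
          simp [Fin.succ_inj]
          ring
        intro p v hv
        induction p using Polynomial.induction_on' generalizing v with
        | add p q hp hq =>
          obtain ⟨w, hw, h⟩ := hp hv
          obtain ⟨w', hw', h'⟩ := hq hv
          refine ⟨w + w', W.add_mem hw hw', fun a ha => ?_⟩
          obtain ⟨s, hs⟩ := h a ha
          obtain ⟨s', hs'⟩ := h' a ha
          exact ⟨s + s', by rw [C_add, ← hs, ← hs']; simp; ring⟩
        | monomial j r =>
          rw [← C_mul_X_pow_eq_monomial, mul_smul]
          refine hC r _ ?_
          induction j with
          | zero => simpa using hv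
          | succ j ih =>
            rw [pow_succ', mul_smul]
            exact hX _ ih }
  have hN : v ∈ N := by
    rw [← Finset.univ_sum_single v]
    refine N.sum_mem fun a _ => ?_
    have : (Pi.single a (v a) : Fin (n + 1) → A[X]) = v a • Pi.single a (1 : A[X]) := by
      rw [← Pi.single_smul]; simp
    rw [this]
    refine N.smul_mem _ ⟨0, W.zero_mem, fun c _ => ?_⟩
    by_cases h : c = a
    · exact ⟨1, by simp [h]⟩
    · exact ⟨0, by simp [h]⟩
  exact hN

theorem sum_mul_eq_zero_of_mem_span {P : Matrix (Fin (n + 1)) (Fin n) A}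
    {F : Fin (n + 1) → A[X]} (hF : IsRel P F) {w : Fin (n + 1) → A[X]}
    (hw : w ∈ Submodule.span A[X] (Set.range (relMatrix P).col)) : ∑ a, w a * F a = 0 := by
  induction hw using Submodule.span_induction with
  | mem w hw =>
    obtain ⟨b, rfl⟩ := hw
    exact (sum_relMatrix_mul P F b).trans (sub_eq_zero.2 (hF b))
  | zero => simp
  | add w w' _ _ h h' => simp [add_mul, Finset.sum_add_distrib, h, h']
  | smul r w _ h => simp [mul_assoc, ← Finset.mul_sum, h]

/-- All other terms have degree at most n, and F 0 is monic of degree n; a nonconstant v 0 would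
push the sum beyond degree n. -/
theorem HasLeading.exists_eq_C [IsDomain A] {F : Fin (n + 1) → A[X]} {α : Fin (n + 1) → A}
    (hF : HasLeading F α) (h0 : α 0 = 1) {v : Fin (n + 1) → A[X]}
    (hv : ∀ a, a ≠ 0 → ∃ s, v a = C s) (hd : (∑ a, v a * F a).natDegree ≤ n) :
    ∃ s : Fin (n + 1) → A, v = fun a => C (s a) := by
  have h1 : ∃ s, v 0 = C s := by
    have h2 : (v 0 * F 0).natDegree ≤ n := by
      have : v 0 * F 0 = ∑ a, v a * F a - ∑ a ∈ Finset.univ.erase 0, v a * F a := by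
        rw [← Finset.add_sum_erase _ _ (Finset.mem_univ 0)]; simp
      rw [this]
      refine (natDegree_sub_le _ _).trans (max_le hd
        (natDegree_sum_le_of_forall_le _ _ fun a ha => ?_))
      obtain ⟨s, hs⟩ := hv a (by simpa using ha)
      rw [hs]
      exact (natDegree_C_mul_le _ _).trans ((hF.natDegree_le a).trans (Nat.sub_le _ _))
    have h3 : (F 0).Monic :=
      monic_of_natDegree_le_of_coeff_eq_one n (by simpa using hF.natDegree_le 0)
        (by simpa [h0] using hF.coeff 0)
    have h4 : (F 0).natDegree = n := by
      refine le_antisymm (by simpa using hF.natDegree_le 0) (le_natDegree_of_ne_zero ?_)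
      have := hF.coeff 0
      rw [h0] at this
      simp at this
      simp [this]
    by_cases hv0 : v 0 = 0
    · exact ⟨0, by simp [hv0]⟩
    rw [natDegree_mul hv0 h3.ne_zero, h4] at h2
    exact ⟨_, eq_C_of_natDegree_le_zero (by omega)⟩
  choose! s hs using hv
  obtain ⟨s0, hs0⟩ := h1
  refine ⟨fun a => if a = 0 then s0 else s a, funext fun a => ?_⟩
  by_cases ha : a = 0
  · simp [ha, hs0]
  · simp [ha, hs a ha]

/-- The syzygy half of Hilbert–Burch: modulo the columns a syzygy becomes a constant vector, which
vanishes by linear independence. -/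
theorem HasLeading.mem_span_col_iff [IsDomain A] {P : Matrix (Fin (n + 1)) (Fin n) A}
    {F : Fin (n + 1) → A[X]} {α : Fin (n + 1) → A} (hF : HasLeading F α) (hrel : IsRel P F)
    (h0 : α 0 = 1) (hα : ∀ a, α a ≠ 0) (v : Fin (n + 1) → A[X]) :
    v ∈ Submodule.span A[X] (Set.range (relMatrix P).col) ↔ ∑ a, v a * F a = 0 := by
  refine ⟨sum_mul_eq_zero_of_mem_span hrel, fun h => ?_⟩
  obtain ⟨w, hw, hs⟩ := exists_normalForm P v
  have h1 : ∑ a, (v - w) a * F a = 0 := by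
    simp [sub_mul, Finset.sum_sub_distrib, h, sum_mul_eq_zero_of_mem_span hrel hw]
  obtain ⟨s, hs'⟩ := hF.exists_eq_C h0 (v := v - w) hs (by rw [h1]; simp)
  rw [hs'] at h1
  rw [hF.linearIndependent hα s h1] at hs'
  have : v = w := by
    rw [← sub_eq_zero, hs']
    funext; simp
  rwa [this]

/-- An element of low degree of the ideal generated by `F` is a combination, with constant
coefficients, of the members of `F` of low degree. -/
theorem HasLeading.exists_sum_eq [IsDomain A] {P : Matrix (Fin (n + 1)) (Fin n) A}
    {F : Fin (n + 1) → A[X]} {α : Fin (n + 1) → A} (hF : HasLeading F α) (hrel : IsRel P F)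
    (h0 : α 0 = 1) (hα : ∀ a, α a ≠ 0) {f : A[X]} (hf : f ∈ Ideal.span (Set.range F))
    {i : ℕ} (hi : i ≤ n) (hd : f.natDegree ≤ n - i) :
    ∃ s : Fin (n + 1) → A, (∀ a : Fin (n + 1), (a : ℕ) < i → s a = 0) ∧
      f = ∑ a, C (s a) * F a := by
  obtain ⟨v, rfl⟩ := (Ideal.mem_span_range_iff_exists_fun).1 hf
  obtain ⟨w, hw, hs⟩ := exists_normalForm P v
  have h1 : ∑ a, (v - w) a * F a = ∑ a, v a * F a := by
    simp [sub_mul, Finset.sum_sub_distrib, sum_mul_eq_zero_of_mem_span hrel hw]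
  obtain ⟨s, hs'⟩ := hF.exists_eq_C h0 (v := v - w) hs (by rw [h1]; exact hd.trans (Nat.sub_le _ _))
  rw [hs'] at h1
  refine ⟨s, fun a ha => ?_, h1.symm⟩
  refine hF.coeff_zero_of_sum hα s i (fun c hc => ?_) a ha
  rw [h1]
  refine coeff_eq_zero_of_natDegree_lt (hd.trans_lt ?_)
  have := c.is_lt
  omega

end Relations

/-! ### Normal forms over K[y]: uniqueness, staircase, existence. -/

section Canonical

variable {K : Type*} [Field K] {n : ℕ}

/-- Lower triangular matrices with monic diagonal entries of degree `δ b` and entries of degree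
less than `δ b` below the diagonal. -/
structure IsCanonical (δ : Fin n → ℕ) (P : Matrix (Fin (n + 1)) (Fin n) K[X]) : Prop where
  lower : IsLowerTri P
  monic : ∀ b : Fin n, (P b.castSucc b).Monic
  natDegree : ∀ b : Fin n, (P b.castSucc b).natDegree = δ b
  degree_lt : ∀ (a : Fin (n + 1)) (b : Fin n), b.succ ≤ a → (P a b).degree < δ b

/-- The product of the first diagonal entries. -/
noncomputable def diagProd (P : Matrix (Fin (n + 1)) (Fin n) K[X]) : Fin (n + 1) → K[X] :=
  Fin.partialProd fun b => P b.castSucc b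

theorem diagProd_zero (P : Matrix (Fin (n + 1)) (Fin n) K[X]) : diagProd P 0 = 1 :=
  Fin.partialProd_zero _

theorem diagProd_succ (P : Matrix (Fin (n + 1)) (Fin n) K[X]) (b : Fin n) :
    diagProd P b.succ = diagProd P b.castSucc * P b.castSucc b :=
  Fin.partialProd_succ _ b

variable {δ : Fin n → ℕ} {P P' : Matrix (Fin (n + 1)) (Fin n) K[X]}

theorem IsCanonical.diag_ne_zero (hP : IsCanonical δ P) (b : Fin n) : P b.castSucc b ≠ 0 :=
  (hP.monic b).ne_zero

theorem IsCanonical.diagProd_monic (hP : IsCanonical δ P) (i : Fin (n + 1)) :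
    (diagProd P i).Monic := by
  induction i using Fin.induction with
  | zero => rw [diagProd_zero]; exact monic_one
  | succ b ih => rw [diagProd_succ]; exact ih.mul (hP.monic b)

theorem IsCanonical.natDegree_diagProd (hP : IsCanonical δ P) {μ : Fin (n + 1) → ℕ} (h0 : μ 0 = 0)
    (hμ : ∀ b : Fin n, μ b.succ = μ b.castSucc + δ b) (i : Fin (n + 1)) :
    (diagProd P i).natDegree = μ i := by
  induction i using Fin.induction with
  | zero => rw [diagProd_zero, h0, natDegree_one]
  | succ b ih =>
    rw [diagProd_succ, (hP.diagProd_monic _).natDegree_mul (hP.monic b), ih, hP.natDegree, hμ]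

theorem IsCanonical.hasLeading (hP : IsCanonical δ P) :
    HasLeading (signedMinor (relMatrix P)) (diagProd P) :=
  hP.lower.hasLeading hP.diag_ne_zero

theorem signedMinor_last_eq_diagProd (hP : IsLowerTri P) :
    signedMinor (relMatrix P) (Fin.last n) = C (diagProd P (Fin.last n)) := by
  rw [signedMinor_last hP, diagProd, Fin.partialProd, Fin.val_last,
    List.take_of_length_le (by simp), List.prod_ofFn]

/-- The ideal generated by the signed maximal minors of `relMatrix P`. -/
noncomputable def relIdeal (P : Matrix (Fin (n + 1)) (Fin n) K[X]) : Ideal K[X][X] :=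
  Ideal.span (Set.range (signedMinor (relMatrix P)))

theorem signedMinor_mem_relIdeal (P : Matrix (Fin (n + 1)) (Fin n) K[X]) (a : Fin (n + 1)) :
    signedMinor (relMatrix P) a ∈ relIdeal P :=
  Ideal.subset_span ⟨a, rfl⟩

theorem IsCanonical.exists_sum_eq (hP : IsCanonical δ P) {f : K[X][X]} (hf : f ∈ relIdeal P)
    {i : ℕ} (hi : i ≤ n) (hd : f.natDegree ≤ n - i) :
    ∃ s : Fin (n + 1) → K[X], (∀ a : Fin (n + 1), (a : ℕ) < i → s a = 0) ∧
      f = ∑ a, C (s a) * signedMinor (relMatrix P) a :=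
  hP.hasLeading.exists_sum_eq (isRel_signedMinor P) (diagProd_zero P)
    (fun a => (hP.diagProd_monic a).ne_zero) hf hi hd

theorem IsCanonical.linearIndependent (hP : IsCanonical δ P) (s : Fin (n + 1) → K[X])
    (h : ∑ c, C (s c) * signedMinor (relMatrix P) c = 0) : s = 0 :=
  hP.hasLeading.linearIndependent (fun a => (hP.diagProd_monic a).ne_zero) s h

theorem HasLeading.coeff_sum {A : Type*} [CommRing A] {F : Fin (n + 1) → A[X]}
    {α : Fin (n + 1) → A} (hF : HasLeading F α) {s : Fin (n + 1) → A} (i : Fin (n + 1))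
    (hs : ∀ a < i, s a = 0) : (∑ a, C (s a) * F a).coeff (n - i) = s i * α i := by
  rw [finsetSum_coeff, Finset.sum_eq_single i]
  · rw [coeff_C_mul, hF.coeff]
  · intro c _ hc
    rcases lt_or_gt_of_ne hc with hc | hc
    · simp [hs c hc]
    · rw [coeff_C_mul, coeff_eq_zero_of_natDegree_lt, mul_zero]
      refine (hF.natDegree_le c).trans_lt ?_
      have := c.is_lt
      have := Fin.lt_def.1 hc
      omega
  · simp

theorem IsCanonical.diagProd_dvd_coeff (hP : IsCanonical δ P) {f : K[X][X]} (hf : f ∈ relIdeal P)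
    (i : Fin (n + 1)) (hd : f.natDegree ≤ n - i) : diagProd P i ∣ f.coeff (n - i) := by
  obtain ⟨s, hs, rfl⟩ := hP.exists_sum_eq hf (Nat.lt_succ_iff.1 i.is_lt) hd
  rw [hP.hasLeading.coeff_sum i fun a ha => hs a ha]
  exact dvd_mul_left _ _

/-- Relations with remainders in normal form are trivial. -/
theorem IsCanonical.eq_zero_of_relation (hP : IsCanonical δ P) {b : Fin n} {g : K[X][X]}
    (hg : g ∈ relIdeal P) {r : Fin (n + 1) → K[X]} (hr : ∀ a, b.succ ≤ a → (r a).degree < δ b)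
    (h : C (P b.castSucc b) * g =
      ∑ a ∈ Finset.Ici b.succ, C (r a) * signedMinor (relMatrix P) a) :
    g = 0 ∧ ∀ a, b.succ ≤ a → r a = 0 := by
  -- Only members of index beyond b occur on the right, so g has X-degree below n - b and is itself
  -- a combination of those members.
  have hd : g.natDegree ≤ n - (b + 1 : ℕ) := by
    have h1 : (C (P b.castSucc b) * g).natDegree = g.natDegree :=
      natDegree_C_mul (hP.diag_ne_zero b)
    rw [← h1, h]
    refine natDegree_sum_le_of_forall_le _ _ fun a ha => (natDegree_C_mul_le _ _).trans
      ((hP.hasLeading.natDegree_le a).trans ?_)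
    have := Fin.le_def.1 (Finset.mem_Ici.1 ha)
    simp only [Fin.val_succ] at this
    omega
  obtain ⟨s, hs, hg'⟩ := hP.exists_sum_eq hg b.is_lt hd
  have h2 : ∑ a, C (P b.castSucc b * s a - if b.succ ≤ a then r a else 0) *
      signedMinor (relMatrix P) a = 0 := by
    simp only [C_sub, sub_mul, Finset.sum_sub_distrib, C_mul, mul_assoc, ← Finset.mul_sum]
    rw [← hg', h, sub_eq_zero, ← Finset.sum_subset (Finset.subset_univ (Finset.Ici b.succ))]
    · exact Finset.sum_congr rfl fun a ha => by rw [if_pos (by simpa using ha)]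
    · intro a _ ha
      rw [if_neg (by simpa using ha)]; simp
  have h3 := fun a => congrFun (hP.linearIndependent _ h2) a
  -- Comparing coefficients, r a is a multiple of the diagonal entry, whose degree δ b exceeds that
  -- of r a.
  have h4 : ∀ a, s a = 0 := fun a => by
    by_cases ha : b.succ ≤ a
    · have h5 := h3 a
      simp only [if_pos ha, Pi.zero_apply, sub_eq_zero] at h5
      have h6 := hr a ha
      by_contra hne
      rw [← h5, degree_mul, degree_eq_natDegree (hP.diag_ne_zero b), hP.natDegree,
        degree_eq_natDegree hne] at h6
      norm_cast at h6
      omega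
    · refine hs a ?_
      simpa [Fin.le_def] using ha
  refine ⟨by rw [hg']; simp [h4], fun a ha => ?_⟩
  simpa [h4, ha] using h3 a

/-- Each `diagProd` entry is the monic generator of the leading coefficients in its degree, so it
depends on the ideal only. -/
theorem IsCanonical.diagProd_eq (hP : IsCanonical δ P) (hP' : IsCanonical δ P')
    (h : relIdeal P = relIdeal P') : diagProd P = diagProd P' := by
  have key : ∀ {P P' : Matrix (Fin (n + 1)) (Fin n) K[X]}, IsCanonical δ P → IsCanonical δ P' →
      relIdeal P = relIdeal P' → ∀ i, diagProd P i ∣ diagProd P' i := by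
    intro P P' hP hP' h i
    rw [← hP'.hasLeading.coeff i]
    refine hP.diagProd_dvd_coeff ?_ i (hP'.hasLeading.natDegree_le i)
    rw [h]
    exact signedMinor_mem_relIdeal _ _
  funext i
  exact eq_of_monic_of_associated (hP.diagProd_monic i) (hP'.diagProd_monic i)
    (associated_of_dvd_dvd (key hP hP' h i) (key hP' hP h.symm i))

/-- The diagonals agree because their partial products do. For the rest, descending induction makes
the later minors agree; the difference of the two relations for b then has remainders as
coefficients, so `IsCanonical.eq_zero_of_relation` applies. -/
theorem IsCanonical.ext (hP : IsCanonical δ P) (hP' : IsCanonical δ P')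
    (h : relIdeal P = relIdeal P') : P = P' := by
  have hα := hP.diagProd_eq hP' h
  have hq : ∀ b : Fin n, P b.castSucc b = P' b.castSucc b := fun b => by
    have h1 := diagProd_succ P b
    rw [hα, diagProd_succ P' b] at h1
    exact (mul_left_cancel₀ (hP'.diagProd_monic _).ne_zero h1).symm
  have key : ∀ i : Fin (n + 1), signedMinor (relMatrix P) i = signedMinor (relMatrix P') i ∧
      ∀ b : Fin n, b.castSucc = i → ∀ a, b.succ ≤ a → P a b = P' a b := by
    intro i
    induction i using WellFoundedGT.induction with
    | ind i ih =>
      rcases Fin.eq_castSucc_or_eq_last i with ⟨b, rfl⟩ | rfl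
      · have hih : ∀ a, b.succ ≤ a → signedMinor (relMatrix P') a = signedMinor (relMatrix P) a :=
          fun a ha => (ih a (lt_of_lt_of_le b.castSucc_lt_succ ha)).1.symm
        have h1 := isRel_signedMinor P b
        have h2 := isRel_signedMinor P' b
        rw [hP.lower.sum_eq] at h1
        rw [hP'.lower.sum_eq, ← hq, hih _ le_rfl, ← h1] at h2
        rw [Finset.sum_congr rfl (g := fun a => C (P' a b) * signedMinor (relMatrix P) a)
          fun a ha => by rw [hih a (by simpa using ha)]] at h2
        have h3 : C (P b.castSucc b) * (signedMinor (relMatrix P) b.castSucc -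
            signedMinor (relMatrix P') b.castSucc) =
            ∑ a ∈ Finset.Ici b.succ, C (P' a b - P a b) * signedMinor (relMatrix P) a := by
          simp only [C_sub, sub_mul, Finset.sum_sub_distrib]
          linear_combination -h2
        obtain ⟨h4, h5⟩ := hP.eq_zero_of_relation (Ideal.sub_mem _ (signedMinor_mem_relIdeal _ _)
          (by rw [h]; exact signedMinor_mem_relIdeal _ _)) (fun a ha => (degree_sub_le _ _).trans_lt
            (max_lt (hP'.degree_lt a b ha) (hP.degree_lt a b ha))) h3
        refine ⟨sub_eq_zero.1 h4, fun b' hb' a ha => ?_⟩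
        obtain rfl := Fin.castSucc_injective _ hb'
        exact (sub_eq_zero.1 (h5 a ha)).symm
      · refine ⟨?_, fun b hb => absurd hb (Fin.castSucc_lt_last b).ne⟩
        rw [signedMinor_last_eq_diagProd hP.lower, signedMinor_last_eq_diagProd hP'.lower, hα]
  ext1 a b
  rcases lt_trichotomy a b.castSucc with hab | rfl | hab
  · rw [hP.lower a b hab, hP'.lower a b hab]
  · exact hq b
  · exact (key _).2 b rfl a (by rw [Fin.le_def]; exact Fin.lt_def.1 hab)

/-- `μ i` is the least degree of a leading coefficient of an element of `J` of degree `n - i`. -/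
def HasStaircase (J : Ideal K[X][X]) (μ : Fin (n + 1) → ℕ) : Prop :=
  ∀ (i : Fin (n + 1)) (c : ℕ), (∃ f ∈ J, f ≠ 0 ∧ f.natDegree = n - i ∧ f.leadingCoeff.natDegree = c) ↔ μ i ≤ c

theorem IsCanonical.hasStaircase (hP : IsCanonical δ P) {μ : Fin (n + 1) → ℕ} (h0 : μ 0 = 0)
    (hμ : ∀ b : Fin n, μ b.succ = μ b.castSucc + δ b) : HasStaircase (relIdeal P) μ := by
  intro i c
  rw [← hP.natDegree_diagProd h0 hμ i]
  constructor
  · rintro ⟨f, hf, hf0, hd, rfl⟩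
    have := hP.diagProd_dvd_coeff hf i hd.le
    rw [← hd, coeff_natDegree] at this
    exact natDegree_le_of_dvd this (leadingCoeff_ne_zero.2 hf0)
  · intro hc
    have hm := hP.diagProd_monic i
    set F := signedMinor (relMatrix P)
    have h1 : (C (X ^ (c - (diagProd P i).natDegree)) * F i).coeff (n - i) =
        X ^ (c - (diagProd P i).natDegree) * diagProd P i := by
      rw [coeff_C_mul, hP.hasLeading.coeff]
    have hne : X ^ (c - (diagProd P i).natDegree) * diagProd P i ≠ 0 :=
      mul_ne_zero (pow_ne_zero _ X_ne_zero) hm.ne_zero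
    have hdeg : (C (X ^ (c - (diagProd P i).natDegree)) * F i).natDegree = n - i :=
      le_antisymm ((natDegree_C_mul_le _ _).trans (hP.hasLeading.natDegree_le i))
        (le_natDegree_of_ne_zero (by rw [h1]; exact hne))
    refine ⟨C (X ^ (c - (diagProd P i).natDegree)) * F i,
      Ideal.mul_mem_left _ _ (signedMinor_mem_relIdeal _ _), ?_, hdeg, ?_⟩
    · intro h
      rw [h, coeff_zero] at h1
      exact hne h1.symm
    · rw [leadingCoeff, hdeg, h1, (monic_X_pow _).natDegree_mul hm, natDegree_X_pow]
      omega

/-- Normalise an element whose leading coefficient has least degree. A nonzero remainder on dividing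
another coefficient by it would be a leading coefficient of smaller degree. -/
theorem HasStaircase.exists_leading {J : Ideal K[X][X]} {μ : Fin (n + 1) → ℕ}
    (hJ : HasStaircase J μ) (i : Fin (n + 1)) :
    ∃ α : K[X], α.Monic ∧ α.natDegree = μ i ∧
      (∃ f ∈ J, f.natDegree ≤ n - i ∧ f.coeff (n - i) = α) ∧
      ∀ f ∈ J, f.natDegree ≤ n - i → α ∣ f.coeff (n - i) := by
  obtain ⟨f, hf, hf0, hd, hc⟩ := (hJ i (μ i)).2 le_rfl
  have hl : f.leadingCoeff ≠ 0 := leadingCoeff_ne_zero.2 hf0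
  set γ := f.leadingCoeff.leadingCoeff⁻¹ with hγ
  have hm : (f.leadingCoeff * C γ).Monic := monic_mul_leadingCoeff_inv hl
  have hmd : (f.leadingCoeff * C γ).natDegree = μ i := by
    rw [natDegree_mul_leadingCoeff_inv _ hl, hc]
  have hgd : (C (C γ) * f).natDegree ≤ n - i := (natDegree_C_mul_le _ _).trans hd.le
  have hgc : (C (C γ) * f).coeff (n - i) = f.leadingCoeff * C γ := by
    rw [coeff_C_mul, ← hd, coeff_natDegree, mul_comm]
  have hgJ : C (C γ) * f ∈ J := Ideal.mul_mem_left _ _ hf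
  refine ⟨_, hm, hmd, ⟨_, hgJ, hgd, hgc⟩, fun g hg hgd' => ?_⟩
  set α := f.leadingCoeff * C γ
  rw [← modByMonic_eq_zero_iff_dvd hm]
  by_contra hne
  set h := g - C (g.coeff (n - i) /ₘ α) * (C (C γ) * f)
  have h1 : h.coeff (n - i) = g.coeff (n - i) %ₘ α := by
    rw [coeff_sub, coeff_C_mul, hgc, modByMonic_eq_sub_mul_div]
    ring
  have h2 : h.natDegree = n - i :=
    le_antisymm ((natDegree_sub_le _ _).trans (max_le hgd' ((natDegree_C_mul_le _ _).trans hgd)))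
      (le_natDegree_of_ne_zero (by rw [h1]; exact hne))
  have h3 : h ≠ 0 := by
    intro h0
    rw [h0, coeff_zero] at h1
    exact hne h1.symm
  have h4 := (hJ i _).1 ⟨h, J.sub_mem hg (J.mul_mem_left _ hgJ), h3, h2, rfl⟩
  rw [leadingCoeff, h2, h1, ← hmd] at h4
  have := natDegree_modByMonic_lt (g.coeff (n - i)) hm
  -- The strict bound on `natDegree` of a remainder fails for the divisor 1, but there the remainder
  -- is 0.
  by_cases hα : α = 1
  · rw [hα] at hne
    simp at hne
  · exact absurd (this hα) (not_lt.2 h4)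

/-- The normalisation step: replacing the member i by g plus the quotients of the coefficients by q
leaves only remainders modulo q in the relation. -/
theorem sum_mul_update (F : Fin (n + 1) → K[X][X]) (s : Fin (n + 1) → K[X]) (q : K[X])
    (g : K[X][X]) {i : Fin (n + 1)} (hi : s i = 0) :
    ∑ a, C (if a = i then q else s a %ₘ q) *
      Function.update F i (g + ∑ a, C (s a /ₘ q) * F a) a = C q * g + ∑ a, C (s a) * F a := by
  have h1 : ∀ a, C (s a) * F a = C q * (C (s a /ₘ q) * F a) + C (s a %ₘ q) * F a := fun a => by
    conv_lhs => rw [← modByMonic_add_div (s a) q]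
    rw [C_add, C_mul]
    ring
  have h2 : ∑ a, C (s a) * F a = C q * ∑ a, C (s a /ₘ q) * F a +
      ∑ a ∈ Finset.univ.erase i, C (s a %ₘ q) * F a := by
    rw [Finset.sum_congr rfl fun a _ => h1 a, Finset.sum_add_distrib, Finset.mul_sum,
      ← Finset.add_sum_erase _ (fun a => C (s a %ₘ q) * F a) (Finset.mem_univ i)]
    simp [hi]
  rw [h2, ← add_assoc, ← mul_add, ← Finset.add_sum_erase _ _ (Finset.mem_univ i)]
  refine congrArg₂ _ (by simp) (Finset.sum_congr rfl fun a ha => ?_)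
  have ha' : a ≠ i := by simpa using ha
  simp [ha']

set_option maxHeartbeats 1000000 in
/-- By descending induction on `i`: the members with index `≥ i` of a family in `J` with the
prescribed leading coefficients `α`, whose relations are in normal form. -/
theorem exists_canonical_family {J : Ideal K[X][X]} {α : Fin (n + 1) → K[X]} {q : Fin n → K[X]}
    (hf : ∀ i : Fin (n + 1), ∃ f ∈ J, f.natDegree ≤ n - i ∧ f.coeff (n - i) = α i)
    (hdvd : ∀ i : Fin (n + 1), ∀ f ∈ J, f.natDegree ≤ n - i → α i ∣ f.coeff (n - i))
    (hqm : ∀ b, (q b).Monic) (hq : ∀ b : Fin n, α b.succ = α b.castSucc * q b) (i : Fin (n + 1)) :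
    ∃ (F : Fin (n + 1) → K[X][X]) (P : Matrix (Fin (n + 1)) (Fin n) K[X]),
      (∀ a, i ≤ a → F a ∈ J ∧ (F a).natDegree ≤ n - a ∧ (F a).coeff (n - a) = α a) ∧
      (∀ b : Fin n, i ≤ b.castSucc → P b.castSucc b = q b ∧ (∀ a < b.castSucc, P a b = 0) ∧
        (∀ a, b.succ ≤ a → (P a b).degree < (q b).degree) ∧
        ∑ a, C (P a b) * F a = X * F b.succ) ∧
      ∀ f ∈ J, f.natDegree ≤ n - i → ∃ s : Fin (n + 1) → K[X], (∀ a < i, s a = 0) ∧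
        f = ∑ a, C (s a) * F a := by
  induction i using Fin.reverseInduction with
  | last =>
    obtain ⟨f, hfJ, hfd, hfc⟩ := hf (Fin.last n)
    refine ⟨fun _ => f, 0, fun a ha => ?_, fun b hb => ?_, fun g hg hgd => ?_⟩
    · obtain rfl := Fin.last_le_iff.1 ha
      exact ⟨hfJ, hfd, hfc⟩
    · exact absurd (Fin.castSucc_lt_last b) (not_lt.2 hb)
    · obtain ⟨w, hw⟩ := hdvd _ g hg hgd
      simp only [Fin.val_last, Nat.sub_self, Nat.le_zero] at hfd hfc hgd hw
      refine ⟨Pi.single (Fin.last n) w, fun a ha => by simp [ha.ne], ?_⟩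
      rw [Finset.sum_eq_single (Fin.last n) (fun a _ ha => by simp [ha]) (by simp),
        eq_C_of_natDegree_eq_zero hfd, eq_C_of_natDegree_eq_zero hgd, hfc, hw]
      simp [mul_comm]
  | cast b ih =>
    obtain ⟨F, P, hF, hP, hspan⟩ := ih
    obtain ⟨g, hgJ, hgd, hgc⟩ := hf b.castSucc
    simp only [Fin.val_castSucc] at hgd hgc
    have hbn := b.is_lt
    obtain ⟨hsJ, hsd, hsc⟩ := hF b.succ le_rfl
    simp only [Fin.val_succ] at hsd hsc
    -- Both terms have coefficient α b.succ = α b.castSucc * q b in degree n - b. The difference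
    -- drops in degree, so the induction hypothesis expands it in the later members.
    obtain ⟨s, hs, hsum⟩ := hspan (X * F b.succ - C (q b) * g)
      (J.sub_mem (J.mul_mem_left _ hsJ) (J.mul_mem_left _ hgJ)) (by
        rw [Fin.val_succ, Nat.sub_add_eq]
        refine natDegree_le_pred ((natDegree_sub_le _ _).trans (max_le (natDegree_mul_le.trans ?_)
          ((natDegree_C_mul_le _ _).trans hgd))) ?_
        · rw [natDegree_X]; omega
        · rw [coeff_sub, coeff_C_mul, hgc, show n - (b : ℕ) = n - (b + 1 : ℕ) + 1 by omega,
            coeff_X_mul, hsc, hq, mul_comm, sub_self])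
    -- The correction involves only members of smaller X-degree, so g' keeps the leading coefficient
    -- of g.
    set g' := g + ∑ a, C (s a /ₘ q b) * F a with hg'
    have hs0 : ∀ a < b.succ, s a /ₘ q b = 0 := fun a ha => by rw [hs a ha]; simp
    have hT : ∀ a, C (s a /ₘ q b) * F a ∈ J ∧
        (C (s a /ₘ q b) * F a).natDegree ≤ n - (b + 1 : ℕ) := fun a => by
      by_cases ha : a < b.succ
      · rw [hs0 a ha]; simp
      · obtain ⟨h1, h2, -⟩ := hF a (not_lt.1 ha)
        refine ⟨J.mul_mem_left _ h1, (natDegree_C_mul_le _ _).trans (h2.trans ?_)⟩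
        have := Fin.le_def.1 (not_lt.1 ha)
        simp only [Fin.val_succ] at this
        omega
    have hTd : (∑ a, C (s a /ₘ q b) * F a).natDegree ≤ n - (b + 1 : ℕ) :=
      natDegree_sum_le_of_forall_le _ _ fun a _ => (hT a).2
    have hg'J : g' ∈ J := J.add_mem hgJ (J.sum_mem fun a _ => (hT a).1)
    have hg'd : g'.natDegree ≤ n - b :=
      (natDegree_add_le _ _).trans (max_le hgd (hTd.trans (by omega)))
    have hg'c : g'.coeff (n - b) = α b.castSucc := by
      rw [hg', coeff_add, hgc, coeff_eq_zero_of_natDegree_lt (hTd.trans_lt (by omega)), add_zero]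
    set F' := Function.update F b.castSucc g' with hF'
    have hF'b : F' b.castSucc = g' := by simp [hF']
    have hF'a : ∀ a, a ≠ b.castSucc → F' a = F a := fun a ha => by simp [hF', ha]
    have hsucc : ∀ a, b.castSucc ≤ a → a ≠ b.castSucc → b.succ ≤ a := fun a h1 h2 => by
      have := lt_of_le_of_ne h1 h2.symm
      rw [Fin.le_def]; exact Fin.lt_def.1 this
    refine ⟨F', Matrix.of fun a b' => if b' = b then (if a = b.castSucc then q b else s a %ₘ q b)
      else P a b', fun a ha => ?_, fun b' hb' => ?_, fun f hfJ hfd => ?_⟩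
    · by_cases hab : a = b.castSucc
      · rw [hab, hF'b]
        exact ⟨hg'J, hg'd, hg'c⟩
      · rw [hF'a a hab]
        exact hF a (hsucc a ha hab)
    · by_cases hbb : b' = b
      · subst hbb
        have hne : ∀ a, b'.succ ≤ a → a ≠ b'.castSucc := fun a ha =>
          (lt_of_lt_of_le b'.castSucc_lt_succ ha).ne'
        refine ⟨by simp, fun a ha => ?_, fun a ha => ?_, ?_⟩
        · simp [ha.ne, hs a (ha.trans b'.castSucc_lt_succ)]
        · simp only [Matrix.of_apply, if_true, hne a ha, if_false]
          exact degree_modByMonic_lt _ (hqm _)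
        · rw [hF'a _ (hne _ le_rfl)]
          have h1 : X * F b'.succ = C (q b') * g + ∑ a, C (s a) * F a := by rw [← hsum]; ring
          rw [h1, ← sum_mul_update F s (q b') g (hs _ b'.castSucc_lt_succ)]
          simp only [Matrix.of_apply, if_true, ← hg', ← hF']
      · have hlt : b < b' := by
          have := Fin.le_def.1 hb'
          rw [Fin.lt_def]
          have := Fin.val_ne_of_ne hbb
          simp only [Fin.val_castSucc] at *
          omega
        obtain ⟨h1, h2, h3, h4⟩ := hP b' (by
          rw [Fin.le_def]; rw [Fin.lt_def] at hlt; simpa using hlt)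
        refine ⟨by simp [hbb, h1], fun a ha => by simp [hbb, h2 a ha], fun a ha => by
          simpa [hbb] using h3 a ha, ?_⟩
        rw [hF'a b'.succ, ← h4]
        · refine Finset.sum_congr rfl fun a _ => ?_
          by_cases hab : a = b.castSucc
          · have : P a b' = 0 := h2 a (by rw [hab]; simpa using hlt)
            simp [hbb, this]
          · simp [hbb, hF'a a hab]
        · rw [Ne, Fin.ext_iff]
          rw [Fin.lt_def] at hlt
          simp only [Fin.val_succ, Fin.val_castSucc]
          omega
    · obtain ⟨w, hw⟩ := hdvd _ f hfJ hfd
      simp only [Fin.val_castSucc] at hfd hw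
      obtain ⟨s', hs', hsum'⟩ := hspan (f - C w * g') (J.sub_mem hfJ (J.mul_mem_left _ hg'J)) (by
        rw [Fin.val_succ, Nat.sub_add_eq]
        refine natDegree_le_pred ((natDegree_sub_le _ _).trans (max_le hfd
          ((natDegree_C_mul_le _ _).trans hg'd))) ?_
        rw [coeff_sub, coeff_C_mul, hg'c, hw, mul_comm, sub_self])
      refine ⟨fun a => if a = b.castSucc then w else s' a, fun a ha => ?_, ?_⟩
      · simp [ha.ne, hs' a (ha.trans b.castSucc_lt_succ)]
      · have h1 : f = C w * g' + ∑ a, C (s' a) * F a := by rw [← hsum']; ring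
        rw [h1, ← Finset.add_sum_erase _ _ (Finset.mem_univ b.castSucc),
          ← Finset.add_sum_erase (a := b.castSucc) _ _ (Finset.mem_univ b.castSucc),
          hs' _ b.castSucc_lt_succ, hF'b]
        simp only [C_0, zero_mul, zero_add, if_true]
        congr 1
        refine Finset.sum_congr rfl fun a ha => ?_
        have ha' : a ≠ b.castSucc := by simpa using ha
        simp [ha', hF'a]

theorem HasStaircase.exists_canonical {J : Ideal K[X][X]} {μ : Fin (n + 1) → ℕ}
    (hJ : HasStaircase J μ) (h0 : μ 0 = 0)
    (hμ : ∀ b : Fin n, μ b.succ = μ b.castSucc + δ b) :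
    ∃ P, IsCanonical δ P ∧ relIdeal P = J := by
  choose α hαm hαd hf hdvd using hJ.exists_leading
  -- Multiplying an element by X raises its degree and keeps its leading coefficient.
  have hq : ∀ b : Fin n, α b.castSucc ∣ α b.succ := fun b => by
    obtain ⟨f, hfJ, hfd, hfc⟩ := hf b.succ
    have hbn := b.is_lt
    simp only [Fin.val_succ] at hfd hfc
    have := hdvd b.castSucc (X * f) (J.mul_mem_left _ hfJ) (natDegree_mul_le.trans (by
      rw [natDegree_X, Fin.val_castSucc]; omega))
    rwa [Fin.val_castSucc, show n - (b : ℕ) = n - (b + 1 : ℕ) + 1 by omega, coeff_X_mul,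
      hfc] at this
  choose q hq using hq
  have hqm : ∀ b, (q b).Monic := fun b =>
    (hαm b.castSucc).of_mul_monic_left (by rw [← hq]; exact hαm _)
  have hqd : ∀ b, (q b).natDegree = δ b := fun b => by
    have h1 := hαd b.succ
    rw [hq, (hαm _).natDegree_mul (hqm b), hαd, hμ] at h1
    omega
  obtain ⟨F, P, hF, hP, hspan⟩ := exists_canonical_family hf hdvd hqm hq 0
  simp only [Fin.zero_le, forall_true_left] at hF hP
  have hcan : IsCanonical δ P :=
    { lower := fun a b hab => (hP b).2.1 a hab
      monic := fun b => (hP b).1 ▸ hqm b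
      natDegree := fun b => (hP b).1 ▸ hqd b
      degree_lt := fun a b hab => by
        rw [← hqd b, ← degree_eq_natDegree (hqm b).ne_zero]
        exact (hP b).2.2.1 a hab }
  have hα0 : α 0 = 1 := (hαm 0).natDegree_eq_zero.1 (by rw [hαd, h0])
  have hα : α = diagProd P := by
    funext i
    induction i using Fin.induction with
    | zero => rw [hα0, diagProd_zero]
    | succ b ih => rw [diagProd_succ, hq, ih, (hP b).1]
  have hFm : F = signedMinor (relMatrix P) := by
    refine IsRel.ext (fun b => (hP b).2.2.2) (isRel_signedMinor P) hcan.lower hcan.diag_ne_zero ?_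
    rw [signedMinor_last_eq_diagProd hcan.lower, ← hα]
    obtain ⟨-, h1, h2⟩ := hF (Fin.last n)
    simp only [Fin.val_last, Nat.sub_self, Nat.le_zero] at h1 h2
    rw [eq_C_of_natDegree_eq_zero h1, h2]
  refine ⟨P, hcan, le_antisymm ?_ fun f hfJ => ?_⟩
  · refine Ideal.span_le.2 ?_
    rintro _ ⟨a, rfl⟩
    rw [← hFm]
    exact (hF a).1
  -- Since α 0 = 1, division by F 0 reduces any element of J to degree at most n, where `hspan`
  -- applies.
  · have h1 : (F 0).Monic := monic_of_natDegree_le_of_coeff_eq_one n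
      (by simpa using (hF 0).2.1) (by simpa [hα0] using (hF 0).2.2)
    have hmem : ∀ a, F a ∈ relIdeal P := fun a => by rw [hFm]; exact signedMinor_mem_relIdeal _ _
    have h2 : f %ₘ F 0 ∈ J := by
      rw [modByMonic_eq_sub_mul_div]
      exact J.sub_mem hfJ (J.mul_mem_right _ (hF 0).1)
    obtain ⟨s, -, hs⟩ := hspan _ h2 (natDegree_modByMonic_le f h1 |>.trans (hF 0).2.1)
    rw [← modByMonic_add_div f (F 0), hs]
    exact Ideal.add_mem _ (Ideal.sum_mem _ fun a _ => Ideal.mul_mem_left _ _ (hmem a))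
      (Ideal.mul_mem_right _ _ (hmem 0))

end Canonical

/-! ### From k[x, y] with the lexicographic order to k[y][x]. -/

section Transfer

variable (k : Type*) [Field k]

/-- The identification of `k[x, y]` with `k[y][x]`. -/
noncomputable def polyEquiv : R k ≃ₐ[k] Polynomial (Polynomial k) :=
  (MvPolynomial.finSuccEquiv k 1).trans
    (Polynomial.mapAlgEquiv (MvPolynomial.uniqueAlgEquiv k (Fin 1)))

/-- The exponent vector of `x ^ a * y ^ b`. -/
noncomputable def mon (a b : ℕ) : Fin 2 →₀ ℕ :=
  Finsupp.cons a (Finsupp.single (default : Fin 1) b)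

@[simp] theorem mon_zero (a b : ℕ) : mon a b 0 = a := rfl

@[simp] theorem mon_one (a b : ℕ) : mon a b 1 = b := by
  change Finsupp.cons a (Finsupp.single (default : Fin 1) b) (Fin.succ 0) = b
  rw [Finsupp.cons_succ]
  simp

theorem eq_mon (s : Fin 2 →₀ ℕ) : s = mon (s 0) (s 1) := by
  ext i
  fin_cases i <;> simp

theorem mon_le_mon {a b a' b' : ℕ} : mon a b ≤ mon a' b' ↔ a ≤ a' ∧ b ≤ b' := by
  simp [Finsupp.le_def, Fin.forall_fin_two]

variable {k}

theorem monomial_mon (a b : ℕ) :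
    (MvPolynomial.monomial (mon a b) (1 : k) : R k) =
      MvPolynomial.X 0 ^ a * MvPolynomial.X 1 ^ b := by
  rw [MvPolynomial.monomial_eq, Finsupp.prod_fintype _ _ (by simp)]
  simp

theorem coeff_coeff_polyEquiv (f : R k) (a b : ℕ) :
    ((polyEquiv k f).coeff a).coeff b = MvPolynomial.coeff (mon a b) f := by
  rw [polyEquiv, AlgEquiv.trans_apply, Polynomial.coe_mapAlgEquiv, Polynomial.coeff_map]
  exact (MvPolynomial.coeff_uniqueAlgEquiv k _ b).trans
    (MvPolynomial.finSuccEquiv_coeff_coeff _ _ _)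

@[simp] theorem polyEquiv_X_zero : polyEquiv k (MvPolynomial.X 0) = Polynomial.X := by
  simp [polyEquiv, MvPolynomial.finSuccEquiv_X_zero]

@[simp] theorem polyEquiv_X_one :
    polyEquiv k (MvPolynomial.X 1) = Polynomial.C Polynomial.X := by
  have := MvPolynomial.finSuccEquiv_X_succ (R := k) (n := 1) (j := 0)
  rw [Fin.succ_zero_eq_one] at this
  rw [polyEquiv, AlgEquiv.trans_apply, this]
  simp

@[simp] theorem polyEquiv_aeval (p : Polynomial k) :
    polyEquiv k (Polynomial.aeval (MvPolynomial.X 1 : R k) p) = Polynomial.C p := by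
  have h : (polyEquiv k : R k →ₐ[k] _).comp (Polynomial.aeval (MvPolynomial.X 1 : R k)) =
      (IsScalarTower.toAlgHom k (Polynomial k) (Polynomial (Polynomial k))) := by
    ext
    simp [Polynomial.algebraMap_eq]
  exact DFunLike.congr_fun h p

/-- The order compares exponents of x first and breaks ties by exponents of y. -/
theorem lex_degree_eq {f : R k} (hf : f ≠ 0) :
    MonomialOrder.lex.degree f =
      mon (polyEquiv k f).natDegree (polyEquiv k f).leadingCoeff.natDegree := by
  have hf' : polyEquiv k f ≠ 0 := by simpa using hf
  apply MonomialOrder.lex.toSyn.injective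
  apply le_antisymm
  · rw [MonomialOrder.degree_le_iff]
    intro s hs
    rw [eq_mon s] at hs ⊢
    set a := s 0
    set b := s 1
    rw [MvPolynomial.mem_support_iff, ← coeff_coeff_polyEquiv] at hs
    have ha : a ≤ (polyEquiv k f).natDegree := Polynomial.le_natDegree_of_ne_zero fun h => by
      simp [h] at hs
    rw [MonomialOrder.lex_le_iff]
    rcases ha.eq_or_lt with ha | ha
    · refine Finsupp.toLex_monotone (mon_le_mon.2 ⟨ha.le, ?_⟩)
      rw [Polynomial.leadingCoeff, ← ha]
      exact Polynomial.le_natDegree_of_ne_zero hs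
    · refine le_of_lt ?_
      rw [Finsupp.Lex.lt_iff]
      exact ⟨0, by simp, by simpa using ha⟩
  · refine MonomialOrder.le_degree ?_
    rw [MvPolynomial.mem_support_iff, ← coeff_coeff_polyEquiv, Polynomial.coeff_natDegree,
      Polynomial.coeff_natDegree]
    simpa using hf'

/-- The ideal of `k[y][x]` corresponding to an ideal of `k[x, y]`. -/
noncomputable def toPoly (I : Ideal (R k)) : Ideal (Polynomial (Polynomial k)) :=
  Ideal.comap (polyEquiv k).symm I

theorem polyEquiv_mem_toPoly {I : Ideal (R k)} {f : R k} :
    polyEquiv k f ∈ toPoly I ↔ f ∈ I := by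
  simp [toPoly, Ideal.mem_comap]

theorem toPoly_injective : Function.Injective (toPoly (k := k)) := fun I J h => by
  ext f
  rw [← polyEquiv_mem_toPoly, h, polyEquiv_mem_toPoly]

theorem toPoly_span (s : Set (R k)) :
    toPoly (Ideal.span s) = Ideal.span (polyEquiv k '' s) := by
  exact (Ideal.comap_symm (polyEquiv k).toRingEquiv).trans (Ideal.map_span _ _)

theorem Lt_eq_span (I : Ideal (R k)) :
    Lt I = Ideal.span ((fun s => MvPolynomial.monomial s (1 : k)) ''
      {s | ∃ f ∈ I, f ≠ 0 ∧ s = MonomialOrder.lex.degree f}) := by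
  rw [Lt]
  congr 1
  ext g
  constructor
  · rintro ⟨f, hf, hf0, rfl⟩
    exact ⟨_, ⟨f, hf, hf0, rfl⟩, rfl⟩
  · rintro ⟨_, ⟨f, hf, hf0, rfl⟩, rfl⟩
    exact ⟨f, hf, hf0, rfl⟩

theorem monomial_mem_Lt {I : Ideal (R k)} (a b : ℕ) :
    MvPolynomial.monomial (mon a b) (1 : k) ∈ Lt I ↔
      ∃ f ∈ toPoly I, f ≠ 0 ∧ f.natDegree = a ∧ f.leadingCoeff.natDegree = b := by
  rw [Lt_eq_span, MvPolynomial.mem_ideal_span_monomial_image]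
  constructor
  · intro h
    obtain ⟨_, ⟨f, hf, hf0, rfl⟩, hle⟩ := h (mon a b) (by simp)
    rw [lex_degree_eq hf0, mon_le_mon] at hle
    set g := polyEquiv k f with hg
    have hg0 : g ≠ 0 := by simpa [hg] using hf0
    have hl0 : g.leadingCoeff ≠ 0 := Polynomial.leadingCoeff_ne_zero.2 hg0
    -- Multiplying by the missing powers of x and y realises every multiple of a leading monomial as
    -- a leading monomial.
    refine ⟨Polynomial.C (Polynomial.X ^ (b - g.leadingCoeff.natDegree)) *
      (Polynomial.X ^ (a - g.natDegree) * g), Ideal.mul_mem_left _ _ (Ideal.mul_mem_left _ _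
        (polyEquiv_mem_toPoly.2 hf)), ?_, ?_, ?_⟩
    · simp [hg0]
    · rw [Polynomial.natDegree_C_mul (by simp), Polynomial.natDegree_X_pow_mul _ hg0]
      omega
    · rw [Polynomial.leadingCoeff_mul, Polynomial.leadingCoeff_mul, Polynomial.leadingCoeff_C,
        Polynomial.leadingCoeff_X_pow, one_mul, Polynomial.natDegree_X_pow_mul _ hl0]
      omega
  · rintro ⟨g, hg, hg0, rfl, rfl⟩ s hs
    obtain rfl : s = mon g.natDegree g.leadingCoeff.natDegree := by
      simpa using MvPolynomial.support_monomial_subset hs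
    refine ⟨_, ⟨(polyEquiv k).symm g, hg, by simpa using hg0, rfl⟩, ?_⟩
    rw [lex_degree_eq (by simpa using hg0)]
    simp

theorem isMonomialIdeal_Lt (I : Ideal (R k)) : IsMonomialIdeal (Lt I) :=
  ⟨_, Lt_eq_span I⟩

theorem IsMonomialIdeal.le {E E' : Ideal (R k)} (hE : IsMonomialIdeal E)
    (h : ∀ a b, MvPolynomial.monomial (mon a b) (1 : k) ∈ E →
      MvPolynomial.monomial (mon a b) (1 : k) ∈ E') : E ≤ E' := by
  obtain ⟨T, hT⟩ := hE
  have : ∀ s ∈ T, MvPolynomial.monomial s (1 : k) ∈ E := fun s hs => by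
    rw [hT]; exact Ideal.subset_span ⟨s, hs, rfl⟩
  rw [hT]
  refine Ideal.span_le.2 ?_
  rintro _ ⟨s, hs, rfl⟩
  have h1 := this s hs
  rw [eq_mon s] at h1
  have := h _ _ h1
  rwa [← eq_mon s] at this

theorem IsMonomialIdeal.monomial_mem {E : Ideal (R k)} (hE : IsMonomialIdeal E) {f : R k}
    (hf : f ∈ E) {s : Fin 2 →₀ ℕ} (hs : s ∈ f.support) : MvPolynomial.monomial s (1 : k) ∈ E := by
  obtain ⟨T, rfl⟩ := hE
  rw [MvPolynomial.mem_ideal_span_monomial_image] at hf ⊢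
  intro s' hs'
  obtain rfl : s' = s := by simpa using MvPolynomial.support_monomial_subset hs'
  exact hf _ hs

/-- The variable is integral over k in the finite-dimensional quotient. A monic polynomial in it
lies in E, and a monomial ideal contains each monomial of its elements, in particular the top power.
-/
theorem IsMonomialIdeal.exists_pow_mem {E : Ideal (R k)} (hE : IsMonomialIdeal E)
    (hfin : Module.Finite k (R k ⧸ E)) (i : Fin 2) : ∃ j, (MvPolynomial.X i : R k) ^ j ∈ E := by
  obtain ⟨p, hp, h0⟩ := IsIntegral.of_finite k (Ideal.Quotient.mk E (MvPolynomial.X i))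
  refine ⟨p.natDegree, ?_⟩
  have h1 : Polynomial.aeval (MvPolynomial.X i : R k) p ∈ E := by
    rw [← Ideal.Quotient.eq_zero_iff_mem]
    have := Polynomial.aeval_algHom_apply (Ideal.Quotient.mkₐ k E) (MvPolynomial.X i) p
    rw [← Ideal.Quotient.mkₐ_eq_mk k, ← this, Polynomial.aeval_def]
    exact h0
  have h2 : MvPolynomial.coeff (Finsupp.single i p.natDegree)
      (Polynomial.aeval (MvPolynomial.X i : R k) p) = 1 := by
    rw [Polynomial.aeval_eq_sum_range, MvPolynomial.coeff_sum,
      Finset.sum_eq_single p.natDegree]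
    · simp [MvPolynomial.coeff_X_pow, hp]
    · intro c _ hc
      have : Finsupp.single i c ≠ Finsupp.single i p.natDegree := fun h =>
        hc (Finsupp.single_injective i h)
      simp [MvPolynomial.coeff_X_pow, this]
    · simp
  have h3 := hE.monomial_mem h1 (s := Finsupp.single i p.natDegree) (by
    rw [MvPolynomial.mem_support_iff, h2]; exact one_ne_zero)
  rwa [MvPolynomial.X_pow_eq_monomial]

end Transfer

/-! ### The staircase of E and the bijection T₀(E) → V₀(E). -/

section Staircase

variable {k : Type*} [Field k] {E : Ideal (R k)}

theorem X_pow_t_mem (hE : IsMonomialIdeal E) (hfin : Module.Finite k (R k ⧸ E)) :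
    (MvPolynomial.X 0 : R k) ^ t E ∈ E :=
  Nat.sInf_mem (hE.exists_pow_mem hfin 0)

theorem X_pow_mul_mem_iff (hE : IsMonomialIdeal E) (hfin : Module.Finite k (R k ⧸ E)) (i b : ℕ) :
    (MvPolynomial.X 0 : R k) ^ (t E - i) * MvPolynomial.X 1 ^ b ∈ E ↔ m E i ≤ b := by
  constructor
  · exact fun h => Nat.sInf_le h
  · intro h
    have hne : {j | (MvPolynomial.X 0 : R k) ^ (t E - i) * MvPolynomial.X 1 ^ j ∈ E}.Nonempty := by
      obtain ⟨j, hj⟩ := hE.exists_pow_mem hfin 1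
      exact ⟨j, E.mul_mem_left _ hj⟩
    have h1 : (MvPolynomial.X 0 : R k) ^ (t E - i) * MvPolynomial.X 1 ^ m E i ∈ E :=
      Nat.sInf_mem hne
    rw [← Nat.sub_add_cancel h, pow_add, mul_left_comm]
    exact E.mul_mem_left _ h1

theorem m_zero (hE : IsMonomialIdeal E) (hfin : Module.Finite k (R k ⧸ E)) : m E 0 = 0 :=
  Nat.le_zero.1 ((X_pow_mul_mem_iff hE hfin 0 0).1 (by simpa using X_pow_t_mem hE hfin))

theorem m_mono (hE : IsMonomialIdeal E) (hfin : Module.Finite k (R k ⧸ E)) : Monotone (m E) := by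
  refine fun i j hij => (X_pow_mul_mem_iff hE hfin i _).1 ?_
  have h := (X_pow_mul_mem_iff hE hfin j _).2 le_rfl
  rw [show t E - i = (t E - i - (t E - j)) + (t E - j) by omega, pow_add, mul_assoc]
  exact E.mul_mem_left _ h

theorem m_succ (hE : IsMonomialIdeal E) (hfin : Module.Finite k (R k ⧸ E)) (i : ℕ) :
    m E (i + 1) = m E i + d E (i + 1) := by
  have := m_mono hE hfin (Nat.le_succ i)
  simp only [Nat.succ_eq_add_one] at this
  rw [d, Nat.add_sub_cancel]
  omega

theorem m_pos (hE : IsMonomialIdeal E) (hfin : Module.Finite k (R k ⧸ E)) {i : ℕ} (hi : 1 ≤ i)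
    (ht : 1 ≤ t E) : 0 < m E i := by
  refine lt_of_lt_of_le (Nat.pos_of_ne_zero fun h => ?_) (m_mono hE hfin hi)
  have h1 := (X_pow_mul_mem_iff hE hfin 1 0).2 h.le
  rw [pow_zero, mul_one] at h1
  have : t E ≤ t E - 1 := Nat.sInf_le h1
  omega

theorem t_pos (hE : IsMonomialIdeal E) (hfin : Module.Finite k (R k ⧸ E)) (h : E ≠ ⊤) :
    1 ≤ t E := by
  refine Nat.pos_of_ne_zero fun h0 => h ?_
  have := X_pow_t_mem hE hfin
  rw [h0, pow_zero] at this
  exact (Ideal.eq_top_iff_one _).2 this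

/-- The staircase controls monomials of x-degree at most t; those of larger x-degree are multiples
of x^t, which lies in both ideals. -/
theorem Lt_eq_iff (hE : IsMonomialIdeal E) (hfin : Module.Finite k (R k ⧸ E)) (I : Ideal (R k)) :
    Lt I = E ↔ HasStaircase (toPoly I) fun i : Fin (t E + 1) => m E i := by
  constructor
  · intro h i c
    rw [← monomial_mem_Lt, h, monomial_mon]
    exact X_pow_mul_mem_iff hE hfin i c
  · intro h
    have key : ∀ a b, MvPolynomial.monomial (mon a b) (1 : k) ∈ Lt I ↔
        MvPolynomial.monomial (mon a b) (1 : k) ∈ E := by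
      have h1 : ∀ a ≤ t E, ∀ b, MvPolynomial.monomial (mon a b) (1 : k) ∈ Lt I ↔
          MvPolynomial.monomial (mon a b) (1 : k) ∈ E := fun a ha b => by
        have h2 := h ⟨t E - a, by omega⟩ b
        rw [← monomial_mem_Lt, ← X_pow_mul_mem_iff hE hfin] at h2
        simp only [Nat.sub_sub_self ha] at h2
        rw [h2, monomial_mon]
      intro a b
      rcases le_total a (t E) with ha | ha
      · exact h1 a ha b
      · have h3 : ∀ J : Ideal (R k), MvPolynomial.monomial (mon (t E) 0) (1 : k) ∈ J →
            MvPolynomial.monomial (mon a b) (1 : k) ∈ J := fun J hJ => by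
          rw [monomial_mon, pow_zero, mul_one] at hJ
          rw [monomial_mon, ← Nat.sub_add_cancel ha, pow_add, mul_right_comm]
          exact J.mul_mem_left _ hJ
        have h4 : MvPolynomial.monomial (mon (t E) 0) (1 : k) ∈ E := by
          rw [monomial_mon]; simpa using X_pow_t_mem hE hfin
        exact iff_of_true (h3 _ ((h1 _ le_rfl _).2 h4)) (h3 _ h4)
    exact le_antisymm ((isMonomialIdeal_Lt I).le fun a b => (key a b).1)
      (hE.le fun a b => (key a b).2)

/-- The matrix over `k[y]` whose `relMatrix` is `M₀(E) + N`. -/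
noncomputable def coeffMatrix (E : Ideal (R k))
    (N : Matrix (Fin (t E + 1)) (Fin (t E)) (Polynomial k)) :
    Matrix (Fin (t E + 1)) (Fin (t E)) (Polynomial k) :=
  Matrix.of fun a b => N a b + if a = b.castSucc then Polynomial.X ^ d E (b + 1) else 0

theorem coeffMatrix_diag (N : Matrix (Fin (t E + 1)) (Fin (t E)) (Polynomial k)) (b : Fin (t E)) :
    coeffMatrix E N b.castSucc b = N b.castSucc b + Polynomial.X ^ d E (b + 1) := by
  simp [coeffMatrix]

theorem coeffMatrix_of_ne (N : Matrix (Fin (t E + 1)) (Fin (t E)) (Polynomial k))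
    {a : Fin (t E + 1)} {b : Fin (t E)} (h : a ≠ b.castSucc) : coeffMatrix E N a b = N a b := by
  simp [coeffMatrix, h]

theorem map_pert (N : Matrix (Fin (t E + 1)) (Fin (t E)) (Polynomial k)) :
    (pert E N).map (polyEquiv k) = relMatrix (coeffMatrix E N) := by
  ext1 a b
  have h1 : ((a : ℕ) = (b : ℕ)) ↔ a = b.castSucc := by simp [Fin.ext_iff]
  have h2 : ((a : ℕ) = (b : ℕ) + 1) ↔ a = b.succ := by simp [Fin.ext_iff]
  simp only [Matrix.map_apply, pert, Matrix.add_apply, M0, relMatrix, coeffMatrix, Matrix.of_apply,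
    map_add, polyEquiv_aeval, h1, h2]
  by_cases ha : a = b.castSucc
  · have : b.castSucc ≠ b.succ := (Fin.castSucc_lt_succ).ne
    simp [ha, this, add_comm]
  · by_cases hb : a = b.succ
    · have : b.succ ≠ b.castSucc := (Fin.castSucc_lt_succ).ne'
      simp only [hb, this, if_false, if_true, map_neg, polyEquiv_X_zero, map_zero]
      ring
    · simp [ha, hb]

theorem map_signedMinor {A B : Type*} [CommRing A] [CommRing B] (e : A ≃+* B) {r : ℕ}
    (M : Matrix (Fin (r + 1)) (Fin r) A) (i : Fin (r + 1)) :
    e (signedMinor M i) = signedMinor (M.map e) i := by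
  rw [signedMinor, signedMinor, map_mul, map_pow, map_neg, map_one, RingEquiv.map_det]
  rfl

theorem toPoly_phi (N : Matrix (Fin (t E + 1)) (Fin (t E)) (Polynomial k)) :
    toPoly (phi E N) = relIdeal (coeffMatrix E N) := by
  rw [phi, minorsIdeal_eq_span, toPoly_span, relIdeal, ← map_pert, ← Set.range_comp]
  congr 2
  funext i
  exact map_signedMinor (polyEquiv k).toRingEquiv _ i

/-- The degrees of the diagonal entries. -/
noncomputable def diagDeg (E : Ideal (R k)) (b : Fin (t E)) : ℕ := d E (b + 1)

/-- A polynomial is monic of degree d_j exactly when it is y^{d_j} plus a polynomial of degree below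
d_j. -/
theorem mem_T0_iff (N : Matrix (Fin (t E + 1)) (Fin (t E)) (Polynomial k)) :
    N ∈ T0 E ↔ IsCanonical (diagDeg E) (coeffMatrix E N) := by
  constructor
  · intro h
    have h1 : ∀ b, (N b.castSucc b).degree < (Polynomial.X ^ d E (b + 1) : Polynomial k).degree :=
      fun b => by simpa using (h b.castSucc b).2 (by simp)
    refine ⟨fun a b hab => ?_, fun b => ?_, fun b => ?_, fun a b hab => ?_⟩
    · rw [coeffMatrix_of_ne N hab.ne]
      exact (h a b).1 (by simpa [Fin.lt_def] using hab)
    · rw [coeffMatrix_diag, add_comm]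
      exact (Polynomial.monic_X_pow _).add_of_left (h1 b)
    · rw [coeffMatrix_diag, Polynomial.natDegree_add_eq_right_of_degree_lt (h1 b)]
      simp [diagDeg]
    · rw [coeffMatrix_of_ne N (lt_of_lt_of_le b.castSucc_lt_succ hab).ne']
      refine (h a b).2 ?_
      have := Fin.le_def.1 hab
      simp only [Fin.val_succ] at this
      omega
  · intro h a b
    refine ⟨fun hab => ?_, fun hab => ?_⟩
    · have hab' : a < b.castSucc := by simpa [Fin.lt_def] using hab
      rw [← coeffMatrix_of_ne N hab'.ne]
      exact h.lower a b hab'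
    · by_cases hab' : a = b.castSucc
      · subst hab'
        have h1 : N b.castSucc b = coeffMatrix E N b.castSucc b - Polynomial.X ^ d E (b + 1) := by
          rw [coeffMatrix_diag, add_sub_cancel_right]
        have h2 : (coeffMatrix E N b.castSucc b).degree = d E (b + 1) := by
          rw [Polynomial.degree_eq_natDegree (h.diag_ne_zero b), h.natDegree]
          rfl
        rw [h1, ← h2]
        exact Polynomial.degree_sub_lt_left (by simp [h2]) (h.diag_ne_zero b)
          (by simp [(h.monic b).leadingCoeff])
      · rw [← coeffMatrix_of_ne N hab']
        refine h.degree_lt a b ?_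
        rw [Fin.ext_iff] at hab'
        rw [Fin.le_def]
        simp only [Fin.val_castSucc, Fin.val_succ] at *
        omega

theorem coeffMatrix_bijective (E : Ideal (R k)) : Function.Bijective (coeffMatrix E) := by
  have h : coeffMatrix E = fun N => N + coeffMatrix E 0 := by
    funext N
    ext1 a b
    simp [coeffMatrix]
  rw [h]
  exact (Equiv.addRight _).bijective

theorem hasStaircase_of_mem_T0 (hE : IsMonomialIdeal E) (hfin : Module.Finite k (R k ⧸ E))
    {N : Matrix (Fin (t E + 1)) (Fin (t E)) (Polynomial k)} (hN : N ∈ T0 E) :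
    HasStaircase (toPoly (phi E N)) fun i : Fin (t E + 1) => m E i := by
  rw [toPoly_phi]
  exact ((mem_T0_iff N).1 hN).hasStaircase (m_zero hE hfin) fun b => m_succ hE hfin b

theorem bijOn_phi (hE : IsMonomialIdeal E) (hfin : Module.Finite k (R k ⧸ E)) :
    Set.BijOn (phi E) (T0 E) (V0 E) := by
  refine ⟨fun N hN => (Lt_eq_iff hE hfin _).2 (hasStaircase_of_mem_T0 hE hfin hN),
    fun N hN N' hN' h => ?_, fun I hI => ?_⟩
  · apply (coeffMatrix_bijective E).1
    exact ((mem_T0_iff N).1 hN).ext ((mem_T0_iff N').1 hN') (by rw [← toPoly_phi, h, toPoly_phi])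
  · obtain ⟨P, hP, hPI⟩ := ((Lt_eq_iff hE hfin I).1 hI).exists_canonical (δ := diagDeg E)
      (m_zero hE hfin) fun b => m_succ hE hfin b
    obtain ⟨N, rfl⟩ := (coeffMatrix_bijective E).2 P
    exact ⟨N, (mem_T0_iff N).2 hP, toPoly_injective ((toPoly_phi N).trans hPI)⟩

theorem isHilbertBurch_phi {N : Matrix (Fin (t E + 1)) (Fin (t E)) (Polynomial k)}
    (hN : N ∈ T0 E) : IsHilbertBurch (pert E N) (phi E N) := by
  refine ⟨rfl, fun v => ?_⟩
  have hP := (mem_T0_iff N).1 hN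
  have h1 := hP.hasLeading.mem_span_col_iff (isRel_signedMinor _) (diagProd_zero _)
    (fun a => (hP.diagProd_monic a).ne_zero) (fun a => polyEquiv k (v a))
  have h2 : (∑ a, v a * signedMinor (pert E N) a = 0) ↔ ∑ a, polyEquiv k (v a) *
      signedMinor (relMatrix (coeffMatrix E N)) a = 0 := by
    rw [← map_pert, ← map_eq_zero_iff _ (polyEquiv k).injective, map_sum]
    refine Eq.congr_left (Finset.sum_congr rfl fun a _ => ?_)
    rw [map_mul]
    exact congrArg _ (map_signedMinor (polyEquiv k).toRingEquiv _ a)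
  rw [h2, ← h1, ← map_pert, Submodule.mem_span_range_iff_exists_fun,
    Submodule.mem_span_range_iff_exists_fun]
  constructor
  · rintro ⟨c, rfl⟩
    refine ⟨fun b => polyEquiv k (c b), ?_⟩
    funext a
    simp [Finset.sum_apply]
  · rintro ⟨c, hc⟩
    refine ⟨fun b => (polyEquiv k).symm (c b), ?_⟩
    funext a
    apply (polyEquiv k).injective
    have := congrFun hc a
    simp only [Finset.sum_apply, Pi.smul_apply, smul_eq_mul, Matrix.col_apply,
      Matrix.map_apply] at this
    simp [Finset.sum_apply, ← this]

end Staircase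

/-! ### Conditions (1) and (2) and the radical. -/

section Radical

variable {k : Type*} [Field k] {E : Ideal (R k)}
  {N : Matrix (Fin (t E + 1)) (Fin (t E)) (Polynomial k)}

theorem eq_X_pow_of_monic_of_dvd {p : Polynomial k} (hp : p.Monic) {s : ℕ} (h : p ∣ X ^ s) :
    p = X ^ p.natDegree := by
  obtain ⟨i, -, hi⟩ := (dvd_prime_pow prime_X s).1 h
  have := eq_of_monic_of_associated hp (monic_X_pow i) hi
  rw [this, natDegree_X_pow]

theorem X_one_mem_radical_iff (I : Ideal (R k)) :
    MvPolynomial.X 1 ∈ I.radical ↔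
      ∃ s : ℕ, Polynomial.C (Polynomial.X ^ s) ∈ toPoly I := by
  rw [Ideal.mem_radical_iff]
  refine exists_congr fun s => ?_
  rw [← polyEquiv_mem_toPoly, map_pow, polyEquiv_X_one, map_pow]

theorem cond1_iff_diag :
    Cond1 E N ↔ ∀ b, coeffMatrix E N b.castSucc b = Polynomial.X ^ d E (b + 1) := by
  simp [Cond1, coeffMatrix_diag]

/-- Elements of the ideal free of x are multiples of the last minor, the product of the diagonal
entries. It divides a power of y only if each monic diagonal entry is a power of y. -/
theorem cond1_iff (hN : N ∈ T0 E) :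
    Cond1 E N ↔ MvPolynomial.X 1 ∈ (phi E N).radical := by
  have hP := (mem_T0_iff N).1 hN
  rw [X_one_mem_radical_iff, toPoly_phi, cond1_iff_diag]
  have hlast := signedMinor_last hP.lower
  constructor
  · intro h
    refine ⟨∑ b : Fin (t E), d E (b + 1), ?_⟩
    rw [← Finset.prod_pow_eq_pow_sum, ← Finset.prod_congr rfl fun b _ => h b, ← hlast]
    exact signedMinor_mem_relIdeal _ _
  · rintro ⟨s, hs⟩ b
    have h1 := hP.diagProd_dvd_coeff hs (Fin.last _) (by simp)
    have h2 : diagProd (coeffMatrix E N) (Fin.last _) = ∏ b, coeffMatrix E N b.castSucc b :=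
      Polynomial.C_injective ((signedMinor_last_eq_diagProd hP.lower).symm.trans hlast)
    simp only [Fin.val_last, Nat.sub_self, Polynomial.coeff_C_zero, h2] at h1
    rw [eq_X_pow_of_monic_of_dvd (hP.monic b) ((Finset.dvd_prod_of_mem
      (fun b : Fin (t E) => coeffMatrix E N b.castSucc b) (Finset.mem_univ b)).trans h1), hP.natDegree]
    rfl

theorem diagProd_eq_X_pow (hE : IsMonomialIdeal E) (hfin : Module.Finite k (R k ⧸ E))
    (h1 : Cond1 E N) (i : Fin (t E + 1)) :
    diagProd (coeffMatrix E N) i = Polynomial.X ^ m E i := by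
  induction i using Fin.induction with
  | zero => rw [diagProd_zero, Fin.val_zero, m_zero hE hfin, pow_zero]
  | succ b ih =>
    rw [diagProd_succ, ih, cond1_iff_diag.1 h1, Fin.val_succ, m_succ hE hfin, pow_add,
      Fin.val_castSucc]

theorem apply_eq_zero_of_d_eq_zero (hN : N ∈ T0 E) {a : Fin (t E + 1)} {b : Fin (t E)}
    (h : d E (b + 1) = 0) : N a b = 0 := by
  rcases lt_or_ge (a : ℕ) (b : ℕ) with hab | hab
  · exact (hN a b).1 hab
  · have := (hN a b).2 hab
    rw [h] at this
    simpa [Polynomial.degree_lt_iff_coeff_zero, Polynomial.ext_iff] using this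

theorem le_lastEq_iff (hE : IsMonomialIdeal E) (hfin : Module.Finite k (R k ⧸ E)) {i j : ℕ}
    (hj : j ≤ i) (hi : i ≤ t E) : i ≤ lastEq E j ↔ m E i = m E j := by
  have hbdd : BddAbove {v | j ≤ v ∧ v ≤ t E ∧ m E v = m E j} := ⟨t E, fun v hv => hv.2.1⟩
  constructor
  · intro h
    have hmem : lastEq E j ∈ {v | j ≤ v ∧ v ≤ t E ∧ m E v = m E j} :=
      Nat.sSup_mem ⟨j, le_rfl, hj.trans hi, rfl⟩ hbdd
    exact le_antisymm ((m_mono hE hfin h).trans hmem.2.2.le) (m_mono hE hfin hj)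
  · exact fun h => le_csSup hbdd ⟨hj, hi, h⟩

/-- The index a stands for row a + 1, so the range i ≤ κ + 1 becomes a ≤ κ, that is, m_a = m_j.
Columns with d_j = 0 vanish and impose nothing. -/
theorem cond2_iff_coeff (hE : IsMonomialIdeal E) (hfin : Module.Finite k (R k ⧸ E))
    (hN : N ∈ T0 E) :
    Cond2 E N ↔ ∀ (b : Fin (t E)) (a : Fin (t E + 1)), b.succ ≤ a → m E a = m E (b + 1) →
      (N a b).coeff 0 = 0 := by
  constructor
  · intro h b a hab hm
    rcases Nat.eq_zero_or_pos (d E (b + 1)) with hd | hd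
    · simp [apply_eq_zero_of_d_eq_zero hN hd]
    · have hab' : (b : ℕ) + 1 ≤ a := by simpa using Fin.le_def.1 hab
      exact h b hd a (by omega) (Nat.succ_le_succ
        ((le_lastEq_iff hE hfin hab' (Nat.lt_succ_iff.1 a.is_lt)).2 hm))
  · intro h b _ a hab hla
    have hab' : (b : ℕ) + 1 ≤ a := by omega
    exact h b a (by rw [Fin.le_def]; simpa using hab')
      ((le_lastEq_iff hE hfin hab' (Nat.lt_succ_iff.1 a.is_lt)).1 (by omega))

/-- The first member of a triangular family is a power of `X` if and only if the family has no
constants in its relations. -/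
theorem eq_X_pow_iff_forall_eq_zero {n : ℕ} {μ : Fin (n + 1) → ℕ} (hμ : Monotone μ)
    {g : Fin (n + 1) → Polynomial k} {γ : Fin n → Fin (n + 1) → k}
    (hg : ∀ a, (g a).Monic ∧ (g a).natDegree = n - a)
    (hrel : ∀ b : Fin n, g b.castSucc + ∑ a ∈ Finset.Ici b.succ, C (γ b a) * g a = X * g b.succ)
    (hγ : ∀ b a, b.succ ≤ a → μ a ≠ μ b.succ → γ b a = 0)
    (hγ' : ∀ b a, μ b.succ = μ b.castSucc → γ b a = 0) :
    g 0 = X ^ n ↔ ∀ b a, b.succ ≤ a → γ b a = 0 := by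
  have hstep : ∀ b, (∀ a, b.succ ≤ a → γ b a = 0) → g b.castSucc = X * g b.succ := fun b h => by
    rw [← hrel b, Finset.sum_eq_zero, add_zero]
    intro a ha
    simp [h a (by simpa using ha)]
  constructor
  · intro h0
    have key : ∀ i : Fin (n + 1), g i = X ^ (n - i : ℕ) ∧
        ∀ b : Fin n, b.succ = i → ∀ a, b.succ ≤ a → γ b a = 0 := by
      intro i
      induction i using Fin.induction with
      | zero => exact ⟨by simpa using h0, fun b hb => absurd hb (Fin.succ_ne_zero b)⟩
      | succ b ih =>
        have hz : ∀ a, b.succ ≤ a → γ b a = 0 := by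
          by_contra! hne
          -- Take r to be the last index with a nonzero constant. Between b.succ and r the function
          -- μ does not jump, so each step there is multiplication by X.
          obtain ⟨r, ⟨hbr, hr0⟩, hmax⟩ := Set.exists_max_image
            {a | b.succ ≤ a ∧ γ b a ≠ 0} id (Set.toFinite _) hne
          have hμr : μ r = μ b.succ := by
            by_contra h
            exact hr0 (hγ b r hbr h)
          have hbr' : (b : ℕ) + 1 ≤ r := by simpa using Fin.le_def.1 hbr
          have hblock : ∀ a, b.succ ≤ a → a ≤ r → g a = X ^ (r - a : ℕ) * g r := by
            intro a
            induction a using Fin.reverseInduction with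
            | last =>
              intro _ hr
              obtain rfl := Fin.last_le_iff.1 hr
              simp
            | cast c ihc =>
              intro hbc hcr
              rcases hcr.eq_or_lt with hcr | hcr
              · simp [hcr]
              · have hcs : c.succ ≤ r := by
                  rw [Fin.le_def]; exact Fin.lt_def.1 hcr
                have hμc : μ c.succ = μ c.castSucc :=
                  le_antisymm ((hμ hcs).trans (hμr.le.trans (hμ hbc)))
                    (hμ c.castSucc_lt_succ.le)
                rw [hstep c fun a _ => hγ' c a hμc, ihc (hbc.trans c.castSucc_lt_succ.le) hcs,
                  ← mul_assoc, ← pow_succ']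
                have := Fin.le_def.1 hcs
                simp only [Fin.val_succ] at this
                congr 2
                simp only [Fin.val_succ, Fin.val_castSucc]
                omega
          set p : Polynomial k := X ^ (r - b : ℕ) -
            ∑ a ∈ Finset.Icc b.succ r, C (γ b a) * X ^ (r - a : ℕ) with hp
          have hpg : p * g r = X ^ (n - b : ℕ) := by
            have h1 : ∑ a ∈ Finset.Ici b.succ, C (γ b a) * g a =
                ∑ a ∈ Finset.Icc b.succ r, C (γ b a) * X ^ (r - a : ℕ) * g r := by
              rw [← Finset.sum_subset (s₁ := Finset.Icc b.succ r)]
              · refine Finset.sum_congr rfl fun a ha => ?_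
                obtain ⟨ha1, ha2⟩ := Finset.mem_Icc.1 ha
                rw [hblock a ha1 ha2, mul_assoc]
              · exact fun a ha => Finset.mem_Ici.2 (Finset.mem_Icc.1 ha).1
              · intro a ha ha'
                have ha := Finset.mem_Ici.1 ha
                have : γ b a = 0 := by
                  by_contra hne'
                  exact ha' (Finset.mem_Icc.2 ⟨ha, hmax a ⟨ha, hne'⟩⟩)
                simp [this]
            have h2 := hrel b
            rw [h1, hblock _ le_rfl hbr, ih.1, ← Finset.sum_mul, ← mul_assoc, ← pow_succ',
              Fin.val_succ, show (r - (b + 1) + 1 : ℕ) = r - b by omega, Fin.val_castSucc] at h2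
            rw [hp, sub_mul, ← h2]
            ring
          -- As r > b, only the term a = r contributes to the constant coefficient.
          have hp0 : p.coeff 0 = -γ b r := by
            rw [hp, coeff_sub, coeff_X_pow, if_neg (by omega), finsetSum_coeff,
              Finset.sum_eq_single r]
            · simp
            · intro a ha har
              have := Fin.lt_def.1 (lt_of_le_of_ne (Finset.mem_Icc.1 ha).2 har)
              rw [coeff_C_mul, coeff_X_pow, if_neg (by omega), mul_zero]
            · simp [hbr]
          obtain ⟨i, -, hi⟩ := (dvd_prime_pow prime_X _).1 (Dvd.intro _ hpg)
          have hpd : p.natDegree + (n - r) = n - b := by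
            have hpne : p ≠ 0 := fun h => by
              rw [h, coeff_zero] at hp0
              exact hr0 (neg_eq_zero.1 hp0.symm)
            rw [← (hg r).2, ← natDegree_mul hpne (hg r).1.ne_zero, hpg, natDegree_X_pow]
          have hi' : p.natDegree = i := by
            rw [natDegree_eq_of_degree_eq (degree_eq_degree_of_associated hi), natDegree_X_pow]
          -- p divides a power of X and has degree r - b > 0, so X divides it, against its nonzero
          -- constant coefficient.
          have hdvd : X ∣ p := (dvd_pow_self X (by have := r.is_lt; omega)).trans hi.symm.dvd
          rw [X_dvd_iff, hp0] at hdvd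
          exact hr0 (neg_eq_zero.1 hdvd)
        refine ⟨?_, fun b' hb' => by obtain rfl := Fin.succ_injective _ hb'; exact hz⟩
        have h1 := hstep b hz
        have := b.is_lt
        rw [ih.1, Fin.val_castSucc, show n - (b : ℕ) = n - (b + 1 : ℕ) + 1 by omega,
          pow_succ'] at h1
        rw [Fin.val_succ]
        exact (mul_left_cancel₀ X_ne_zero h1).symm
    exact fun b => (key b.succ).2 b rfl
  · intro h
    have key : ∀ i : Fin (n + 1), g i = X ^ (n - i : ℕ) := by
      intro i
      induction i using Fin.reverseInduction with
      | last =>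
        have := hg (Fin.last n)
        simp only [Fin.val_last, Nat.sub_self] at this ⊢
        rw [pow_zero]
        exact this.1.natDegree_eq_zero.1 this.2
      | cast b ih =>
        have := b.is_lt
        rw [hstep b (h b), ih, ← pow_succ', Fin.val_succ, Fin.val_castSucc]
        congr 1
        omega
    simpa using key 0

/-- The reverse direction uses that (x, y) consists of the polynomials without constant term; a
nonzero constant in the radical would make I the whole ring. -/
theorem radical_eq_span_iff {I : Ideal (R k)} (hI : I ≠ ⊤) :
    I.radical = Ideal.span {MvPolynomial.X 0, MvPolynomial.X 1} ↔
      MvPolynomial.X 0 ∈ I.radical ∧ MvPolynomial.X 1 ∈ I.radical := by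
  constructor
  · intro h
    rw [h]
    exact ⟨Ideal.subset_span (by simp), Ideal.subset_span (by simp)⟩
  · rintro ⟨h0, h1⟩
    have hle : Ideal.span {MvPolynomial.X 0, MvPolynomial.X 1} ≤ I.radical :=
      Ideal.span_le.2 (by rintro _ (rfl | rfl) <;> assumption)
    refine le_antisymm (fun f hf => ?_) hle
    have hset : ({MvPolynomial.X 0, MvPolynomial.X 1} : Set (R k)) =
        MvPolynomial.X '' (Set.univ : Set (Fin 2)) := by
      ext g
      simp [Fin.exists_fin_two, eq_comm]
    have hsub : f - MvPolynomial.C (MvPolynomial.coeff 0 f) ∈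
        Ideal.span ({MvPolynomial.X 0, MvPolynomial.X 1} : Set (R k)) := by
      rw [hset, MvPolynomial.mem_ideal_span_X_image]
      intro s hs
      by_contra! hc
      have : s = 0 := by
        ext i
        simpa using hc i (Set.mem_univ i)
      subst this
      simp at hs
    have hC : MvPolynomial.C (MvPolynomial.coeff 0 f) ∈ I.radical := by
      have := I.radical.sub_mem hf (hle hsub)
      simpa using this
    have hz : MvPolynomial.coeff 0 f = 0 := by
      by_contra hne
      have htop : I.radical = ⊤ := Ideal.eq_top_of_isUnit_mem _ hC
        ((isUnit_iff_ne_zero.2 hne).map MvPolynomial.C)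
      exact hI (Ideal.radical_eq_top.1 htop)
    simpa [hz] using hsub

theorem phi_ne_top (hE : IsMonomialIdeal E) (hfin : Module.Finite k (R k ⧸ E)) (hEt : E ≠ ⊤)
    (hN : N ∈ T0 E) : phi E N ≠ ⊤ := by
  intro h
  have h1 : Lt (phi E N) = E := (bijOn_phi hE hfin).mapsTo hN
  apply hEt
  rw [Ideal.eq_top_iff_one, ← h1]
  refine Ideal.subset_span ⟨1, by rw [h]; trivial, one_ne_zero, ?_⟩
  simp

/-- Modulo y only the first minor survives, so x ∈ √I asks whether its reduction, monic of degree t,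
is x^t. The reduced relations of the factors G carry exactly the constant terms in condition (2),
and `eq_X_pow_iff_forall_eq_zero` decides the question. -/
theorem cond2_iff (hE : IsMonomialIdeal E) (hfin : Module.Finite k (R k ⧸ E)) (hEt : E ≠ ⊤)
    (hN : N ∈ T0 E) (h1 : Cond1 E N) :
    Cond2 E N ↔ MvPolynomial.X 0 ∈ (phi E N).radical := by
  have hP := (mem_T0_iff N).1 hN
  have hlast := signedMinor_last_eq_diagProd hP.lower
  have hdiag := diagProd_eq_X_pow hE hfin h1
  have hmono := m_mono hE hfin
  set P := coeffMatrix E N with hPdef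
  obtain ⟨G, hFG, hG, hGrel⟩ := hP.lower.exists_factor hP.diag_ne_zero
    (diagProd_succ P) (ρ := fun b a => X ^ (m E a - m E (b + 1))) (fun b a hab => by
      rw [hdiag, hdiag, ← pow_add, Fin.val_succ, Nat.add_sub_cancel' (hmono _)]
      simpa using Fin.le_def.1 hab) (isRel_signedMinor P) hlast
  -- ε sets y = 0; γ collects the coefficients of the reduced relations, where the power of y kills
  -- every entry with m_a > m_{b+1}.
  set ε := mapRingHom (evalRingHom (0 : k)) with hε
  set γ : Fin (t E) → Fin (t E + 1) → k := fun b a =>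
    eval 0 (P a b * X ^ (m E a - m E (b + 1))) with hγ
  have hPN : ∀ (b : Fin (t E)) (a : Fin (t E + 1)), b.succ ≤ a → P a b = N a b := fun b a hab =>
    coeffMatrix_of_ne N (lt_of_lt_of_le b.castSucc_lt_succ hab).ne'
  have hg : ∀ a, (ε (G a)).Monic ∧ (ε (G a)).natDegree = t E - a := fun a =>
    ⟨(hG a).1.map _, by rw [← (hG a).2]; exact (hG a).1.natDegree_map _⟩
  have hrel : ∀ b : Fin (t E), ε (G b.castSucc) +
      ∑ a ∈ Finset.Ici b.succ, C (γ b a) * ε (G a) = X * ε (G b.succ) := fun b => by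
    have := congrArg ε (hGrel b)
    rw [map_add, map_sum, map_mul] at this
    simpa [hε, hγ] using this
  have hF0 : ε (signedMinor (relMatrix P) 0) = ε (G 0) := by
    rw [hFG, diagProd_zero, C_1, one_mul]
  have hF1 : ∀ a : Fin (t E + 1), a ≠ 0 → ε (signedMinor (relMatrix P) a) = 0 := fun a ha => by
    have hpos : m E a ≠ 0 := (m_pos hE hfin
      (Nat.pos_of_ne_zero fun h => ha (Fin.ext (by simpa using h))) (t_pos hE hfin hEt)).ne'
    rw [hFG, hdiag]
    simp [hε, hpos]
  have hcond : Cond2 E N ↔ ∀ b a, b.succ ≤ a → γ b a = 0 := by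
    rw [cond2_iff_coeff hE hfin hN]
    refine forall_congr' fun b => forall_congr' fun a => forall_congr' fun hab => ?_
    have hle : m E (b + 1) ≤ m E a := hmono (by simpa using Fin.le_def.1 hab)
    by_cases hm : m E a = m E (b + 1)
    · simp [hγ, hm, hPN b a hab, coeff_zero_eq_eval_zero]
    · have : m E a - m E (b + 1) ≠ 0 := by omega
      simp [hγ, hm, this]
  have hpow : ε (G 0) = X ^ t E ↔ ∀ b a, b.succ ≤ a → γ b a = 0 := by
    -- The truncation to a ≥ b.succ matters: when d_{b+1} = 0 the diagonal entry is 1, so γ itself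
    -- does not vanish on the diagonal.
    have key := eq_X_pow_iff_forall_eq_zero (μ := fun a : Fin (t E + 1) => m E a)
      (fun a b hab => hmono hab) (g := fun a => ε (G a)) (γ := fun b a =>
        if b.succ ≤ a then γ b a else 0) hg (fun b => ?_) (fun b a hab hne => ?_)
        (fun b a heq => ?_)
    · rw [key]
      refine forall_congr' fun b => forall_congr' fun a => forall_congr' fun hab => ?_
      rw [if_pos hab]
    · rw [← hrel b]
      congr 1
      refine Finset.sum_congr rfl fun a ha => ?_
      rw [if_pos (by simpa using ha)]
    · have : m E a - m E (b + 1) ≠ 0 := by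
        have hle : m E (b + 1) ≤ m E a := hmono (by simpa using Fin.le_def.1 hab)
        simp only [Fin.val_succ] at hne
        omega
      simp [hγ, this]
    · by_cases hab : b.succ ≤ a
      · have hd : d E (b + 1) = 0 := by
          have := m_succ hE hfin b
          simp only [Fin.val_succ, Fin.val_castSucc] at heq
          omega
        simp [hγ, hPN b a hab, apply_eq_zero_of_d_eq_zero hN hd]
      · simp [hab]
  rw [hcond, ← hpow]
  constructor
  · intro h
    have hy : polyEquiv k (MvPolynomial.X 1) ∈ (toPoly (phi E N)).radical := by
      obtain ⟨s, hs⟩ := Ideal.mem_radical_iff.1 ((cond1_iff hN).1 h1)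
      exact ⟨s, by rw [← map_pow]; exact polyEquiv_mem_toPoly.2 hs⟩
    rw [polyEquiv_X_one, toPoly_phi] at hy
    -- The first minor is x^t modulo y; as y and the minor lie in the radical, so does x^t.
    have hdvd : C X ∣ X ^ t E - signedMinor (relMatrix P) 0 := by
      rw [C_dvd_iff_dvd_coeff]
      intro i
      rw [X_dvd_iff, coeff_zero_eq_eval_zero]
      have h2 : ε (X ^ t E - signedMinor (relMatrix P) 0) = 0 := by
        rw [map_sub, hF0, h]
        simp [hε]
      have h3 := congrArg (fun q => coeff q i) h2
      rw [coeff_sub, eval_sub, ← coe_evalRingHom, ← coeff_map]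
      simpa [hε, coeff_map] using h3
    have hx : X ^ t E ∈ (relIdeal P).radical := by
      have h2 := Ideal.mem_of_dvd _ hdvd hy
      have h3 := Ideal.add_mem _ h2 (Ideal.le_radical (signedMinor_mem_relIdeal P 0))
      simpa using h3
    obtain ⟨s, hs⟩ := Ideal.mem_radical_of_pow_mem hx
    refine ⟨s, ?_⟩
    rw [← polyEquiv_mem_toPoly, toPoly_phi, map_pow, polyEquiv_X_zero]
    exact hs
  · rintro ⟨s, hs⟩
    rw [← polyEquiv_mem_toPoly, toPoly_phi, map_pow, polyEquiv_X_zero] at hs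
    have hle : relIdeal P ≤ Ideal.comap ε (Ideal.span {ε (G 0)}) := by
      refine Ideal.span_le.2 ?_
      rintro _ ⟨a, rfl⟩
      rw [SetLike.mem_coe, Ideal.mem_comap]
      by_cases ha : a = 0
      · rw [ha, hF0]; exact Ideal.mem_span_singleton_self _
      · rw [hF1 a ha]; exact Ideal.zero_mem _
    have h2 := hle hs
    rw [Ideal.mem_comap, Ideal.mem_span_singleton, map_pow, hε, coe_mapRingHom, map_X] at h2
    have h3 := eq_X_pow_of_monic_of_dvd (hg 0).1 h2
    rwa [(hg 0).2] at h3

end Radical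

/-! ### Condition (3) and homogeneity. -/

section Homogeneous

variable {k : Type*} [Field k] {E : Ideal (R k)}
  {N : Matrix (Fin (t E + 1)) (Fin (t E)) (Polynomial k)}

attribute [local instance] MvPolynomial.gradedAlgebra

theorem homogeneousComponent_mul_of_isHomogeneous (n j : ℕ) (f : R k) {g : R k}
    (hg : g.IsHomogeneous j) :
    MvPolynomial.homogeneousComponent n (f * g) =
      if j ≤ n then MvPolynomial.homogeneousComponent (n - j) f * g else 0 := by
  classical
  have := DirectSum.coe_decompose_mul_of_right_mem
    (MvPolynomial.homogeneousSubmodule (Fin 2) k) n (a := f)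
    ((MvPolynomial.mem_homogeneousSubmodule _ _).2 hg)
  refine (MvPolynomial.decomposition.decompose'_apply (f * g) n).symm.trans (this.trans ?_)
  refine if_congr Iff.rfl (congrArg (· * g) ?_) rfl
  exact MvPolynomial.decomposition.decompose'_apply f (n - j)

theorem homogeneousComponent_aeval (n : ℕ) (p : Polynomial k) :
    MvPolynomial.homogeneousComponent n (Polynomial.aeval (MvPolynomial.X 1 : R k) p) =
      Polynomial.aeval (MvPolynomial.X 1 : R k) (Polynomial.monomial n (p.coeff n)) := by
  induction p using Polynomial.induction_on' with
  | add p q hp hq => simp only [map_add, Polynomial.coeff_add, hp, hq]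
  | monomial j r =>
    have h : (Polynomial.aeval (MvPolynomial.X 1 : R k) (Polynomial.monomial j r)).IsHomogeneous
        j := by
      rw [Polynomial.aeval_monomial]
      exact MvPolynomial.isHomogeneous_C_mul_X_pow _ _ _
    rw [MvPolynomial.homogeneousComponent_of_mem
      ((MvPolynomial.mem_homogeneousSubmodule _ _).2 h), Polynomial.coeff_monomial]
    by_cases hnj : n = j
    · simp [hnj]
    · simp [hnj, Ne.symm hnj]

theorem isHomogeneous_of_X_one_pow_mul {f : R k} {c j : ℕ}
    (h : (MvPolynomial.X 1 ^ c * f).IsHomogeneous (c + j)) : f.IsHomogeneous j := by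
  have h1 := homogeneousComponent_mul_of_isHomogeneous (c + j) c f
    (MvPolynomial.isHomogeneous_X_pow (R := k) (1 : Fin 2) c)
  rw [mul_comm f, MvPolynomial.homogeneousComponent_eq_self h, if_pos (Nat.le_add_right c j),
    Nat.add_sub_cancel_left, mul_comm] at h1
  rw [mul_right_cancel₀ (pow_ne_zero _ (MvPolynomial.X_ne_zero 1)) h1]
  exact MvPolynomial.homogeneousComponent_isHomogeneous _ _

theorem polyEquiv_signedMinor (N : Matrix (Fin (t E + 1)) (Fin (t E)) (Polynomial k))
    (a : Fin (t E + 1)) :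
    polyEquiv k (signedMinor (pert E N) a) = signedMinor (relMatrix (coeffMatrix E N)) a :=
  (map_signedMinor (polyEquiv k).toRingEquiv _ a).trans (congrArg (signedMinor · a) (map_pert N))

theorem signedMinor_pert_relation (hN : N ∈ T0 E) (h1 : Cond1 E N) (b : Fin (t E)) :
    MvPolynomial.X 1 ^ d E (b + 1) * signedMinor (pert E N) b.castSucc +
      ∑ a ∈ Finset.Ici b.succ,
        Polynomial.aeval (MvPolynomial.X 1 : R k) (N a b) * signedMinor (pert E N) a =
      MvPolynomial.X 0 * signedMinor (pert E N) b.succ := by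
  apply (polyEquiv k).injective
  have hP := (mem_T0_iff N).1 hN
  have := isRel_signedMinor (coeffMatrix E N) b
  rw [hP.lower.sum_eq, cond1_iff_diag.1 h1] at this
  simp only [map_add, map_mul, map_sum, map_pow, polyEquiv_X_one, polyEquiv_X_zero,
    polyEquiv_aeval, polyEquiv_signedMinor]
  rw [← this, ← map_pow]
  refine congrArg _ (Finset.sum_congr rfl fun a ha => ?_)
  rw [coeffMatrix_of_ne N (lt_of_lt_of_le b.castSucc_lt_succ (Finset.mem_Ici.1 ha)).ne']

theorem isHomogeneous_signedMinor_last (hE : IsMonomialIdeal E)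
    (hfin : Module.Finite k (R k ⧸ E)) (hN : N ∈ T0 E) (h1 : Cond1 E N) :
    (signedMinor (pert E N) (Fin.last _)).IsHomogeneous (m E (t E)) := by
  have h2 : signedMinor (pert E N) (Fin.last _) = MvPolynomial.X 1 ^ m E (t E) := by
    apply (polyEquiv k).injective
    rw [polyEquiv_signedMinor, signedMinor_last_eq_diagProd ((mem_T0_iff N).1 hN).lower,
      diagProd_eq_X_pow hE hfin h1]
    simp
  rw [h2]
  exact MvPolynomial.isHomogeneous_X_pow _ _

theorem Cond3.cond1 (h : Cond3 E N) : Cond1 E N := fun b =>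
  (h b.castSucc b).1 fun hS => absurd hS.2.1 (lt_irrefl _)

/-- The exponent u_{ij} gives every term of the j-th relation the same total degree. Descending
along the relations, y^{d_j} times the next minor is homogeneous, and the power of y can be
cancelled. -/
theorem Cond3.isHomogeneous_signedMinor (hE : IsMonomialIdeal E)
    (hfin : Module.Finite k (R k ⧸ E)) (hN : N ∈ T0 E) (h : Cond3 E N) (i : Fin (t E + 1)) :
    (signedMinor (pert E N) i).IsHomogeneous (t E - i + m E i) := by
  induction i using WellFoundedGT.induction with
  | ind i ih =>
    rcases Fin.eq_castSucc_or_eq_last i with ⟨b, rfl⟩ | rfl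
    · have hrel := signedMinor_pert_relation hN h.cond1 b
      have hm := m_succ hE hfin b
      have hb := b.is_lt
      refine isHomogeneous_of_X_one_pow_mul (c := d E (b + 1)) ?_
      rw [eq_sub_of_add_eq hrel]
      have hdeg : d E (b + 1) + (t E - (b.castSucc : ℕ) + m E (b.castSucc : ℕ)) =
          1 + (t E - (b.succ : ℕ) + m E (b.succ : ℕ)) := by
        simp only [Fin.val_castSucc, Fin.val_succ]
        omega
      refine MvPolynomial.IsHomogeneous.sub ?_ (MvPolynomial.IsHomogeneous.sum _ _ _ fun a ha => ?_)
      · rw [hdeg]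
        exact (MvPolynomial.isHomogeneous_X _ _).mul (ih _ b.castSucc_lt_succ)
      · have hab := Finset.mem_Ici.1 ha
        by_cases hS : ((a + 1 : ℕ), (b + 1 : ℕ)) ∈ S E
        · obtain ⟨p, hp⟩ := (h a b).2 hS
          have hu := hS.2.2.2.1
          set v := (u E (a + 1) (b + 1)).toNat with hv
          have hv' : (v : ℤ) = u E (a + 1) (b + 1) := Int.toNat_of_nonneg hu
          have ha' := a.is_lt
          have hd : d E (b + 1) + (t E - (b.castSucc : ℕ) + m E (b.castSucc : ℕ)) =
              v + (t E - (a : ℕ) + m E (a : ℕ)) := by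
            rw [hdeg]
            simp only [u, Nat.add_sub_cancel] at hv'
            simp only [Fin.val_succ]
            omega
          rw [hd, hp]
          refine MvPolynomial.IsHomogeneous.mul ?_ (ih a (lt_of_lt_of_le b.castSucc_lt_succ hab))
          rw [map_mul, map_pow, Polynomial.aeval_C, Polynomial.aeval_X]
          exact MvPolynomial.isHomogeneous_C_mul_X_pow _ _ _
        · rw [(h a b).1 hS, map_zero, zero_mul]
          exact MvPolynomial.isHomogeneous_zero _ _ _
    · simpa using isHomogeneous_signedMinor_last hE hfin hN h.cond1

theorem Cond3.isHomogeneous_phi (hE : IsMonomialIdeal E)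
    (hfin : Module.Finite k (R k ⧸ E)) (hN : N ∈ T0 E) (h : Cond3 E N) :
    (phi E N).IsHomogeneous (MvPolynomial.homogeneousSubmodule (Fin 2) k) := by
  rw [phi, minorsIdeal_eq_span]
  refine Ideal.homogeneous_span _ _ ?_
  rintro _ ⟨i, rfl⟩
  exact ⟨_, h.isHomogeneous_signedMinor hE hfin hN i⟩

/-- The last minor is a monic polynomial in y alone, and its top homogeneous component is a power of
y in the ideal. -/
theorem cond1_of_isHomogeneous (hN : N ∈ T0 E)
    (h : (phi E N).IsHomogeneous (MvPolynomial.homogeneousSubmodule (Fin 2) k)) :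
    Cond1 E N := by
  have hP := (mem_T0_iff N).1 hN
  rw [cond1_iff hN]
  set α := diagProd (coeffMatrix E N) (Fin.last _) with hα
  have h1 : Polynomial.aeval (MvPolynomial.X 1 : R k) α ∈ phi E N := by
    rw [← polyEquiv_mem_toPoly, polyEquiv_aeval, toPoly_phi, hα,
      ← signedMinor_last_eq_diagProd hP.lower]
    exact signedMinor_mem_relIdeal _ _
  have h2 := MvPolynomial.homogeneousComponent_mem_of_mem h h1 α.natDegree
  rw [homogeneousComponent_aeval, Polynomial.coeff_natDegree,
    (hP.diagProd_monic _).leadingCoeff, Polynomial.aeval_monomial, map_one, one_mul] at h2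
  exact ⟨_, h2⟩

/-- If `φ(N)` is homogeneous, then so are the entries of `N`. -/
theorem eq_monomial_of_isHomogeneous (hE : IsMonomialIdeal E)
    (hfin : Module.Finite k (R k ⧸ E)) (hN : N ∈ T0 E)
    (h : (phi E N).IsHomogeneous (MvPolynomial.homogeneousSubmodule (Fin 2) k))
    (i : Fin (t E + 1)) :
    (signedMinor (pert E N) i).IsHomogeneous (t E - i + m E i) ∧
      ∀ b : Fin (t E), b.castSucc = i → ∀ a : Fin (t E + 1), b.succ ≤ a →
        N a b = if t E - a + m E a ≤ t E - b + m E (b + 1) then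
          Polynomial.monomial (t E - b + m E (b + 1) - (t E - a + m E a))
            ((N a b).coeff (t E - b + m E (b + 1) - (t E - a + m E a))) else 0 := by
  have hc := cond1_of_isHomogeneous hN h
  have hP := (mem_T0_iff N).1 hN
  induction i using WellFoundedGT.induction with
  | ind i ih =>
    rcases Fin.eq_castSucc_or_eq_last i with ⟨b, rfl⟩ | rfl
    · have hrel := signedMinor_pert_relation hN hc b
      have hm := m_succ hE hfin b
      have hb := b.is_lt
      have hlt : ∀ a, b.succ ≤ a → b.castSucc < a := fun a hab =>
        lt_of_lt_of_le b.castSucc_lt_succ hab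
      set D := t E - b + m E (b + 1) with hD
      set N' : Fin (t E + 1) → Polynomial k := fun a => if t E - a + m E a ≤ D then
          Polynomial.monomial (D - (t E - a + m E a))
            ((N a b).coeff (D - (t E - a + m E a))) else 0 with hN'
      set F := signedMinor (pert E N) with hF
      have hDb : D = d E (b + 1) + (t E - b + m E b) := by omega
      -- D is the degree of x times the next minor. Since the later minors are homogeneous, the
      -- degree-D component of the relation replaces each entry by its single monomial N'.
      have hcomp : MvPolynomial.X 1 ^ d E (b + 1) *
          MvPolynomial.homogeneousComponent (t E - b + m E b) (F b.castSucc) +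
          ∑ a ∈ Finset.Ici b.succ, Polynomial.aeval (MvPolynomial.X 1 : R k) (N' a) * F a =
          MvPolynomial.X 0 * F b.succ := by
        have h1 := congrArg (MvPolynomial.homogeneousComponent D) hrel
        rw [map_add, map_sum, mul_comm, homogeneousComponent_mul_of_isHomogeneous _ _ _
          (MvPolynomial.isHomogeneous_X_pow (R := k) (1 : Fin 2) (d E (b + 1))),
          if_pos (by omega), show D - d E (b + 1) = t E - b + m E b by omega] at h1
        rw [mul_comm, Finset.sum_congr rfl, h1]
        · rw [MvPolynomial.homogeneousComponent_eq_self]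
          have h2 := (MvPolynomial.isHomogeneous_X k (0 : Fin 2)).mul
            (ih _ b.castSucc_lt_succ).1
          rwa [show 1 + (t E - (b.succ : ℕ) + m E (b.succ : ℕ)) = D by
            simp only [Fin.val_succ]; omega] at h2
        · intro a ha
          rw [homogeneousComponent_mul_of_isHomogeneous _ _ _
            (ih a (hlt a (Finset.mem_Ici.1 ha))).1, homogeneousComponent_aeval]
          by_cases hle : t E - a + m E a ≤ D
          · simp only [hN', if_pos hle]
          · simp only [hN', if_neg hle, map_zero, zero_mul]
      have hmemF : F b.castSucc ∈ phi E N := by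
        rw [phi, minorsIdeal_eq_span]
        exact Ideal.subset_span ⟨_, rfl⟩
      have hmem := MvPolynomial.homogeneousComponent_mem_of_mem h hmemF (t E - b + m E b)
      have hdiff : MvPolynomial.X 1 ^ d E (b + 1) * (F b.castSucc -
          MvPolynomial.homogeneousComponent (t E - b + m E b) (F b.castSucc)) =
          ∑ a ∈ Finset.Ici b.succ,
            Polynomial.aeval (MvPolynomial.X 1 : R k) (N' a - N a b) * F a := by
        simp only [map_sub, sub_mul, Finset.sum_sub_distrib]
        linear_combination hrel - hcomp
      have hdiff' := congrArg (polyEquiv k) hdiff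
      simp only [map_mul, map_sum, polyEquiv_aeval, hF, polyEquiv_signedMinor, map_pow,
        polyEquiv_X_one] at hdiff'
      rw [← map_pow, ← cond1_iff_diag.1 hc] at hdiff'
      have hNlt : ∀ a, b.succ ≤ a → (N a b).degree < (diagDeg E b : WithBot ℕ) := fun a hab => by
        rw [← coeffMatrix_of_ne N (hlt a hab).ne']
        exact hP.degree_lt a b hab
      -- Homogeneity of the ideal puts the component of the minor in it, so the difference of the
      -- relation and its component is a relation in normal form, hence trivial.
      obtain ⟨h3, h4⟩ := hP.eq_zero_of_relation (by
          rw [← toPoly_phi, polyEquiv_mem_toPoly]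
          exact Ideal.sub_mem _ hmemF hmem) (fun a hab => by
            refine (Polynomial.degree_sub_le _ _).trans_lt (max_lt ?_ (hNlt a hab))
            refine lt_of_le_of_lt ?_ (hNlt a hab)
            simp only [hN']
            split_ifs
            · by_cases h0 : (N a b).coeff (D - (t E - a + m E a)) = 0
              · simp [h0]
              · rw [Polynomial.degree_monomial _ h0]
                exact Polynomial.le_degree_of_ne_zero h0
            · simp) hdiff'
      refine ⟨?_, fun b' hb' a hab => ?_⟩
      · have h5 := sub_eq_zero.1 ((map_eq_zero_iff _ (polyEquiv k).injective).1 h3)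
        rw [hF, h5]
        exact MvPolynomial.homogeneousComponent_isHomogeneous _ _
      · obtain rfl := Fin.castSucc_injective _ hb'
        exact (sub_eq_zero.1 (h4 a hab)).symm
    · refine ⟨?_, fun b hb => absurd hb (Fin.castSucc_lt_last b).ne⟩
      simpa using isHomogeneous_signedMinor_last hE hfin hN hc

theorem cond3_iff (hE : IsMonomialIdeal E) (hfin : Module.Finite k (R k ⧸ E)) (hN : N ∈ T0 E) :
    Cond3 E N ↔ (phi E N).IsHomogeneous (MvPolynomial.homogeneousSubmodule (Fin 2) k) := by
  refine ⟨fun h => h.isHomogeneous_phi hE hfin hN, fun h a b => ?_⟩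
  have hc := cond1_of_isHomogeneous hN h
  rcases lt_trichotomy a b.castSucc with hab | rfl | hab
  · have hab' : (a : ℕ) < b := by simpa [Fin.lt_def] using hab
    refine ⟨fun _ => (hN a b).1 hab', fun hS => ?_⟩
    have := hS.2.1
    simp only at this
    omega
  · refine ⟨fun _ => hc b, fun hS => absurd hS.2.1 (lt_irrefl _)⟩
  · have hab' : (b : ℕ) < a := by simpa [Fin.lt_def] using hab
    have hab'' : b.succ ≤ a := by rw [Fin.le_def]; simpa using hab'
    have ha := a.is_lt
    have hb := b.is_lt
    have heq := (eq_monomial_of_isHomogeneous hE hfin hN h b.castSucc).2 b rfl a hab''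
    have hu : u E (a + 1) (b + 1) =
        ((t E - b + m E (b + 1) : ℕ) : ℤ) - ((t E - a + m E a : ℕ) : ℤ) := by
      simp only [u, Nat.add_sub_cancel]
      omega
    set D := t E - b + m E (b + 1)
    set D' := t E - a + m E a
    have hlt := (hN a b).2 hab'.le
    constructor
    · intro hS
      rw [heq]
      split_ifs with hle
      · rw [Polynomial.monomial_eq_zero_iff]
        -- Outside S(E) but with u ≥ 0, only u < d_j can fail, so the exponent is at least the
        -- degree bound.
        refine Polynomial.coeff_eq_zero_of_degree_lt (hlt.trans_le ?_)
        norm_cast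
        by_contra! hlt'
        refine hS ⟨Nat.succ_pos _, by simpa using hab', by simp only; omega, ?_, ?_⟩
        · simp only [hu]; omega
        · simp only [hu]; omega
      · rfl
    · intro hS
      have h0 : 0 ≤ u E (a + 1) (b + 1) := hS.2.2.2.1
      have hle : D' ≤ D := by omega
      rw [if_pos hle] at heq
      refine ⟨(N a b).coeff (D - D'), ?_⟩
      have : (u E (a + 1) (b + 1)).toNat = D - D' := by omega
      rw [this, Polynomial.C_mul_X_pow_eq_monomial]
      exact heq

end Homogeneous

end CanonicalHB

theorem theorem3p3 {k : Type*} [Field k] (E : Ideal (CanonicalHB.R k))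
    (hE : CanonicalHB.IsMonomialIdeal E)
    (hfin : Module.Finite k (CanonicalHB.R k ⧸ E)) :
    Set.BijOn (CanonicalHB.phi E) (CanonicalHB.T0 E) (CanonicalHB.V0 E) ∧
    Set.BijOn (CanonicalHB.phi E) (CanonicalHB.T1 E) (CanonicalHB.V1 E) ∧
    (E ≠ ⊤ → Set.BijOn (CanonicalHB.phi E) (CanonicalHB.T2 E) (CanonicalHB.V2 E)) ∧
    Set.BijOn (CanonicalHB.phi E) (CanonicalHB.T3 E) (CanonicalHB.V3 E) ∧
    (∀ I ∈ CanonicalHB.V0 E, ∃! N, N ∈ CanonicalHB.T0 E ∧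
      CanonicalHB.IsHilbertBurch (CanonicalHB.pert E N) I) := by
  have h0 := CanonicalHB.bijOn_phi hE hfin
  -- The other three bijections follow from the first once each condition on N is equivalent to the
  -- matching property of φ(N).
  have restrict : ∀ {p : Matrix (Fin (CanonicalHB.t E + 1)) (Fin (CanonicalHB.t E))
      (Polynomial k) → Prop} {q : Ideal (CanonicalHB.R k) → Prop},
      (∀ N ∈ CanonicalHB.T0 E, p N ↔ q (CanonicalHB.phi E N)) →
      Set.BijOn (CanonicalHB.phi E) {N | N ∈ CanonicalHB.T0 E ∧ p N}
        {I | CanonicalHB.Lt I = E ∧ q I} := by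
    intro p q hpq
    refine ⟨fun N hN => ⟨h0.mapsTo hN.1, (hpq N hN.1).1 hN.2⟩,
      h0.injOn.mono fun N hN => hN.1, ?_⟩
    rintro I ⟨hI, hq⟩
    obtain ⟨N, hN, rfl⟩ := h0.surjOn hI
    exact ⟨N, ⟨hN, (hpq N hN).2 hq⟩, rfl⟩
  refine ⟨h0, restrict fun N hN => CanonicalHB.cond1_iff hN, fun hEt => restrict fun N hN => ?_,
    restrict fun N hN => CanonicalHB.cond3_iff hE hfin hN, fun I hI => ?_⟩
  · rw [CanonicalHB.radical_eq_span_iff (CanonicalHB.phi_ne_top hE hfin hEt hN),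
      and_comm (a := MvPolynomial.X 0 ∈ _),
      ← CanonicalHB.cond1_iff hN]
    exact and_congr_right fun h1 => CanonicalHB.cond2_iff hE hfin hEt hN h1
  · obtain ⟨N, hN, rfl⟩ := h0.surjOn hI
    refine ⟨N, ⟨hN, CanonicalHB.isHilbertBurch_phi hN⟩, fun N' hN' => ?_⟩
    exact h0.injOn hN'.1 hN hN'.2.1
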